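/- **Theorem.** Let $p,q\ge 1$ be integers with $(p,q)\neq(1,1)$, let $n \ge 0$, and let $f:\mathbb{R}^p\times\mathbb{R}^q\to\mathbb{R}^n$ be an orthogonal multiplication, i.e. a bilinear map with $|f(x,y)|=|x|\,|y|$ for all $x,y$. Then the map $$\phi:\mathbb{R}^p\times\mathbb{R}^q\to\mathbb{R}^{n+1},\qquad \phi(x,y)=\Big(\tfrac{1}{\sqrt2}f(x,y),\tfrac{1}{\sqrt2}\Big)$$ maps $S^{p-1}\times S^{q-1}$ into $S^n$, and its restriction $\phi: S^{p-1}\times S^{q-1}\to S^n$ is a proper biharmonic map, where the unit spheres carry their round metrics and $S^{p-1}\times S^{q-1}$ the product metric. Here, for a smooth map $\varphi:(M,g)\to(N,h)$ of Riemannian manifolds, $\tau(\varphi)=\mathrm{Trace}_g\nabla d\varphi$ is the tension field; $\varphi$ is harmonic if $\tau(\varphi)\equiv 0$; $\varphi$ is biharmonic if it is a critical point of the bienergy $E^2(\varphi,\Omega)=\frac12\int_\Omega|\tau(\varphi)|^2\,dv_g$ for every compact $\Omega\subset M$, that is, $\frac{d}{dt}\big|_{t=0}E^2(\varphi_t,\Omega)=0$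 for every smooth variation $(\varphi_t)_{t\in\mathbb{R}}$ of $\varphi=\varphi_0$ with $\varphi_t=\varphi$ outside $\Omega$; and $\varphi$ is proper biharmonic if it is biharmonic but not harmonic. -/

import Mathlib

open Bundle Set Filter Module MeasureTheory
open scoped Manifold ContDiff Topology

noncomputable section

namespace HarmonicMaps

section Metrics

/-- The pullback `φ^* h` of a field `h` of bilinear forms under `φ : M → N`:
`(φ^* h)_x (v, w) = h_{φ x} (dφ_x v, dφ_x w)`. -/
def pullbackForm {E : Type*} [NormedAddCommGroup E] [NormedSpace ℝ E]
    {H : Type*} [TopologicalSpace H] {I : ModelWithCorners ℝ E H}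
    {M : Type*} [TopologicalSpace M] [ChartedSpace H M]
    {E' : Type*} [NormedAddCommGroup E'] [NormedSpace ℝ E']
    {H' : Type*} [TopologicalSpace H'] {J : ModelWithCorners ℝ E' H'}
    {N : Type*} [TopologicalSpace N] [ChartedSpace H' N]
    (φ : M → N) (h : ∀ y : N, TangentSpace J y →L[ℝ] TangentSpace J y →L[ℝ] ℝ) (x : M) :
    TangentSpace I x →L[ℝ] TangentSpace I x →L[ℝ] ℝ :=
  ((mfderiv I J φ x).precomp ℝ).comp ((h (φ x)).comp (mfderiv I J φ x))

variable {E : Type*} [NormedAddCommGroup E] [NormedSpace ℝ E]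
  {H : Type*} [TopologicalSpace H] {I : ModelWithCorners ℝ E H}
  {M : Type*} [TopologicalSpace M] [ChartedSpace H M]
  {E' : Type*} [NormedAddCommGroup E'] [NormedSpace ℝ E']
  {H' : Type*} [TopologicalSpace H'] {J : ModelWithCorners ℝ E' H'}
  {N : Type*} [TopologicalSpace N] [ChartedSpace H' N]

@[simp] theorem pullbackForm_apply (φ : M → N)
    (h : ∀ y : N, TangentSpace J y →L[ℝ] TangentSpace J y →L[ℝ] ℝ) (x : M)
    (v w : TangentSpace I x) :
    pullbackForm (I := I) φ h x v w = h (φ x) (mfderiv I J φ x v) (mfderiv I J φ x w) := rfl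

theorem contMDiff_pullbackForm [IsManifold I ∞ M] [IsManifold J ∞ N]
    {φ : M → N} (hφ : ContMDiff I J ∞ φ)
    {h : ∀ y : N, TangentSpace J y →L[ℝ] TangentSpace J y →L[ℝ] ℝ}
    (hh : ContMDiff J (J.prod 𝓘(ℝ, E' →L[ℝ] E' →L[ℝ] ℝ)) ∞
      (fun y : N ↦ TotalSpace.mk' (E' →L[ℝ] E' →L[ℝ] ℝ)
        (E := fun y : N ↦ TangentSpace J y →L[ℝ] TangentSpace J y →L[ℝ] ℝ) y (h y))) :
    ContMDiff I (I.prod 𝓘(ℝ, E →L[ℝ] E →L[ℝ] ℝ)) ∞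
      (fun x : M ↦ TotalSpace.mk' (E →L[ℝ] E →L[ℝ] ℝ)
        (E := fun y : M ↦ TangentSpace I y →L[ℝ] TangentSpace I y →L[ℝ] ℝ) x
        (pullbackForm (I := I) φ h x)) := by
  intro x₀
  have h1 := (contMDiffAt_hom_bundle _).1 ((hh (φ x₀)).comp x₀ (hφ x₀))
  have h2 : ContMDiffAt I 𝓘(ℝ, E →L[ℝ] E') ∞
      (inTangentCoordinates I J id φ (fun x ↦ mfderiv I J φ x) x₀) x₀ :=
    ContMDiffAt.mfderiv_const (n := ∞) (m := ∞) (hφ x₀) (by simp)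
  refine (contMDiffAt_hom_bundle _).2 ⟨contMDiffAt_id, ?_⟩
  have key := (h1.2.clm_comp h2)
  have h4 : ContMDiffAt I 𝓘(ℝ, (E' →L[ℝ] ℝ) →L[ℝ] (E →L[ℝ] ℝ)) ∞
      (fun x ↦ ContinuousLinearMap.precomp ℝ
        (inTangentCoordinates I J id φ (fun x ↦ mfderiv I J φ x) x₀ x)) x₀ :=
    h2.clm_precomp
  refine (h4.clm_comp key).congr_of_eventuallyEq ?_
  have e1 : ∀ᶠ x in 𝓝 x₀, x ∈ (trivializationAt E (TangentSpace I) x₀).baseSet :=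
    (trivializationAt E (TangentSpace I) x₀).open_baseSet.mem_nhds
      (FiberBundle.mem_baseSet_trivializationAt' x₀)
  have e2 : ∀ᶠ x in 𝓝 x₀, φ x ∈ (trivializationAt E' (TangentSpace J) (φ x₀)).baseSet :=
    hφ.continuous.continuousAt
      ((trivializationAt E' (TangentSpace J) (φ x₀)).open_baseSet.mem_nhds
        (FiberBundle.mem_baseSet_trivializationAt' (φ x₀)))
  filter_upwards [e1, e2] with x hx hy
  ext v w
  have t1 : ∀ v, (trivializationAt E' (TangentSpace J) (φ x₀)).symm (φ x)
      (inTangentCoordinates I J id φ (fun x ↦ mfderiv I J φ x) x₀ x v) =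
      mfderiv I J φ x ((trivializationAt E (TangentSpace I) x₀).symm x v) := by
    intro v
    change (trivializationAt E' (TangentSpace J) (φ x₀)).symm (φ x)
      (ContinuousLinearMap.inCoordinates E (TangentSpace I) E' (TangentSpace J) x₀ x
        (φ x₀) (φ x) (mfderiv I J φ x) v) = _
    rw [ContinuousLinearMap.inCoordinates_eq hx hy]
    exact (trivializationAt E' (TangentSpace J) (φ x₀)).symm_apply_apply_mk hy _
  have r := inCoordinates_apply_eq₂ (F₁ := E) (F₂ := E) (F₃ := ℝ)
    (E₁ := fun x : M ↦ TangentSpace I x) (E₂ := fun x : M ↦ TangentSpace I x)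
    (E₃ := fun _ : M ↦ ℝ) (ϕ := pullbackForm (I := I) φ h x) (v := v) (w := w) hx hx (by simp)
  have r' := inCoordinates_apply_eq₂ (F₁ := E') (F₂ := E') (F₃ := ℝ)
    (E₁ := fun x : N ↦ TangentSpace J x) (E₂ := fun x : N ↦ TangentSpace J x)
    (E₃ := fun _ : N ↦ ℝ) (ϕ := h (φ x))
    (v := (inTangentCoordinates I J id φ (fun x ↦ mfderiv I J φ x) x₀ x v))
    (w := (inTangentCoordinates I J id φ (fun x ↦ mfderiv I J φ x) x₀ x w)) hy hy (by simp)
  refine r.trans (Eq.trans ?_ r'.symm)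
  rw [t1, t1]
  simp [pullbackForm]

theorem isVonNBounded_of_pos [FiniteDimensional ℝ E] (B : E →L[ℝ] E →L[ℝ] ℝ)
    (hB : ∀ v, v ≠ 0 → 0 < B v v) : Bornology.IsVonNBounded ℝ {v : E | B v v < 1} := by
  have hc : Continuous fun v : E ↦ B v v := by fun_prop
  obtain ⟨c, hc0, hcB⟩ : ∃ c : ℝ, 0 < c ∧ ∀ v : E, ‖v‖ = 1 → c ≤ B v v := by
    rcases (Metric.sphere (0 : E) 1).eq_empty_or_nonempty with h | h
    · refine ⟨1, one_pos, fun v hv ↦ ?_⟩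
      have : v ∈ Metric.sphere (0 : E) 1 := by simpa using hv
      simp [h] at this
    · obtain ⟨u, hu, hmin⟩ := (isCompact_sphere (0 : E) 1).exists_isMinOn h hc.continuousOn
      have hu1 : ‖u‖ = 1 := by simpa using hu
      refine ⟨B u u, hB u (by rintro rfl; simp at hu1), fun v hv ↦ hmin (by simpa using hv)⟩
  rw [NormedSpace.isVonNBounded_iff, isBounded_iff_forall_norm_le]
  refine ⟨1 + c⁻¹, fun v hv ↦ ?_⟩
  rcases eq_or_ne v 0 with rfl | hv0
  · simpa using by positivity
  have hn : 0 < ‖v‖ := norm_pos_iff.2 hv0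
  have h1 := hcB (‖v‖⁻¹ • v) (by simp [norm_smul, hn.ne'])
  simp only [map_smul, smul_apply, smul_eq_mul] at h1
  have h2 : c * ‖v‖ ^ 2 ≤ B v v := by
    have := mul_le_mul_of_nonneg_right h1 (sq_nonneg ‖v‖)
    calc c * ‖v‖ ^ 2 ≤ _ := this
      _ = B v v := by field_simp
  have h3 : c * ‖v‖ ^ 2 < 1 := h2.trans_lt hv
  have h4 : ‖v‖ ^ 2 < c⁻¹ := by
    rw [lt_inv_comm₀ (by positivity) hc0]
    rw [lt_inv_comm₀ hc0 (by positivity)]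
    rw [← one_div, lt_div_iff₀ hc0]
    linarith
  have h5 : 0 < c⁻¹ := by positivity
  nlinarith

/-- The type of smooth Riemannian metrics on `M`. -/
abbrev SmoothMetric {E : Type*} [NormedAddCommGroup E] [NormedSpace ℝ E]
    {H : Type*} [TopologicalSpace H] (I : ModelWithCorners ℝ E H)
    (M : Type*) [TopologicalSpace M] [ChartedSpace H M] [IsManifold I ∞ M] :=
  ContMDiffRiemannianMetric I ∞ E (fun x : M ↦ TangentSpace I x)

/-- The Riemannian metric induced on `M` by an immersion `ι` into an inner product space,
`g_x(v, w) = ⟪dι_x v, dι_x w⟫`. -/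
def inducedMetric [FiniteDimensional ℝ E] [IsManifold I ∞ M]
    {F : Type*} [NormedAddCommGroup F] [InnerProductSpace ℝ F] (ι : M → F)
    (hι : ContMDiff I 𝓘(ℝ, F) ∞ ι)
    (hinj : ∀ x, Function.Injective (mfderiv I 𝓘(ℝ, F) ι x)) : SmoothMetric I M where
  inner := pullbackForm (J := 𝓘(ℝ, F)) ι (riemannianMetricVectorSpace F).inner
  symm _ _ _ := (riemannianMetricVectorSpace F).symm _ _ _
  pos x _ hv := (riemannianMetricVectorSpace F).pos _ _
    (fun h ↦ hv (hinj x (h.trans (map_zero _).symm)))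
  isVonNBounded x := isVonNBounded_of_pos (E := E) _ fun _ hv ↦
    (riemannianMetricVectorSpace F).pos _ _ (fun h ↦ hv (hinj x (h.trans (map_zero _).symm)))
  contMDiff := contMDiff_pullbackForm hι ((riemannianMetricVectorSpace F).contMDiff.of_le le_top)

/-- The round metric of the unit sphere `S^n` in `ℝ^{n+1}`. -/
def sphereMetric (n : ℕ) :
    SmoothMetric (𝓡 n) (Metric.sphere (0 : EuclideanSpace ℝ (Fin (n + 1))) 1) :=
  haveI := Fact.mk (@finrank_euclideanSpace_fin ℝ _ (n + 1))
  inducedMetric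
    ((↑) : Metric.sphere (0 : EuclideanSpace ℝ (Fin (n + 1))) 1 → EuclideanSpace ℝ (Fin (n + 1)))
    contMDiff_coe_sphere injective_mvfderiv_subtypeVal_sphere

theorem contMDiff_add_form [IsManifold I ∞ M]
    {a b : ∀ x : M, TangentSpace I x →L[ℝ] TangentSpace I x →L[ℝ] ℝ}
    (ha : ContMDiff I (I.prod 𝓘(ℝ, E →L[ℝ] E →L[ℝ] ℝ)) ∞
      (fun x : M ↦ TotalSpace.mk' (E →L[ℝ] E →L[ℝ] ℝ)
        (E := fun y : M ↦ TangentSpace I y →L[ℝ] TangentSpace I y →L[ℝ] ℝ) x (a x)))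
    (hb : ContMDiff I (I.prod 𝓘(ℝ, E →L[ℝ] E →L[ℝ] ℝ)) ∞
      (fun x : M ↦ TotalSpace.mk' (E →L[ℝ] E →L[ℝ] ℝ)
        (E := fun y : M ↦ TangentSpace I y →L[ℝ] TangentSpace I y →L[ℝ] ℝ) x (b x))) :
    ContMDiff I (I.prod 𝓘(ℝ, E →L[ℝ] E →L[ℝ] ℝ)) ∞
      (fun x : M ↦ TotalSpace.mk' (E →L[ℝ] E →L[ℝ] ℝ)
        (E := fun y : M ↦ TangentSpace I y →L[ℝ] TangentSpace I y →L[ℝ] ℝ) x (a x + b x)) :=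
  ha.add_section hb

theorem prodMetric_pos [IsManifold I ∞ M] [IsManifold J ∞ N]
    (g : SmoothMetric I M) (h : SmoothMetric J N) (z : M × N)
    (v : TangentSpace (I.prod J) z) (hv : v ≠ 0) :
    0 < (pullbackForm (I := I.prod J) (J := I) Prod.fst g.inner z +
      pullbackForm (I := I.prod J) (J := J) Prod.snd h.inner z) v v := by
  have e1 : mfderiv (I.prod J) I Prod.fst z v = v.1 := by rw [mfderiv_fst]; rfl
  have e2 : mfderiv (I.prod J) J Prod.snd z v = v.2 := by rw [mfderiv_snd]; rfl
  change 0 < g.inner z.1 (mfderiv (I.prod J) I Prod.fst z v) (mfderiv (I.prod J) I Prod.fst z v) +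
    h.inner z.2 (mfderiv (I.prod J) J Prod.snd z v) (mfderiv (I.prod J) J Prod.snd z v)
  rw [e1, e2]
  have n1 : ∀ w : TangentSpace I z.1, 0 ≤ g.inner z.1 w w := fun w ↦ by
    rcases eq_or_ne w 0 with rfl | hw
    · simp
    · exact (g.pos _ _ hw).le
  have n2 : ∀ w : TangentSpace J z.2, 0 ≤ h.inner z.2 w w := fun w ↦ by
    rcases eq_or_ne w 0 with rfl | hw
    · simp
    · exact (h.pos _ _ hw).le
  by_cases h1 : v.1 = 0
  · have h2 : v.2 ≠ 0 := fun h2 ↦ hv (Prod.ext h1 h2)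
    exact add_pos_of_nonneg_of_pos (n1 v.1) (h.pos z.2 v.2 h2)
  · exact add_pos_of_pos_of_nonneg (g.pos z.1 v.1 h1) (n2 v.2)

/-- The product metric `g × h` on `M × N`, that is `π₁^* g + π₂^* h`. -/
def prodMetric [FiniteDimensional ℝ E] [FiniteDimensional ℝ E']
    [IsManifold I ∞ M] [IsManifold J ∞ N] (g : SmoothMetric I M) (h : SmoothMetric J N) :
    SmoothMetric (I.prod J) (M × N) where
  inner z := pullbackForm (I := I.prod J) (J := I) Prod.fst g.inner z +
    pullbackForm (I := I.prod J) (J := J) Prod.snd h.inner z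
  symm _ _ _ := congrArg₂ (· + ·) (g.symm _ _ _) (h.symm _ _ _)
  pos z v hv := prodMetric_pos g h z v hv
  isVonNBounded z := isVonNBounded_of_pos (E := E × E') _ fun v hv ↦ prodMetric_pos g h z v hv
  contMDiff :=
    contMDiff_add_form (contMDiff_pullbackForm contMDiff_fst g.contMDiff)
      (contMDiff_pullbackForm contMDiff_snd h.contMDiff)

end Metrics

section Tension

variable {E : Type*} [NormedAddCommGroup E] [NormedSpace ℝ E] [FiniteDimensional ℝ E]
  {H : Type*} [TopologicalSpace H] {I : ModelWithCorners ℝ E H} [I.Boundaryless]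
  {M : Type*} [TopologicalSpace M] [ChartedSpace H M] [IsManifold I ∞ M]
  {E' : Type*} [NormedAddCommGroup E'] [NormedSpace ℝ E'] [FiniteDimensional ℝ E']
  {H' : Type*} [TopologicalSpace H'] {J : ModelWithCorners ℝ E' H'} [J.Boundaryless]
  {N : Type*} [TopologicalSpace N] [ChartedSpace H' N] [IsManifold J ∞ N]

/-- The metric `g` read in the preferred chart at `x₀`: at the point `u` of the chart, the bilinear
form with coefficients `g_{ij}(u)`. -/
def metricInChart (g : SmoothMetric I M) (x₀ : M) (u : E) : E →L[ℝ] E →L[ℝ] ℝ :=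
  pullbackForm (I := 𝓘(ℝ, E)) (J := I) (extChartAt I x₀).symm g.inner u

theorem metricInChart_apply (g : SmoothMetric I M) (x₀ : M) (u v w : E) :
    metricInChart g x₀ u v w = g.inner ((extChartAt I x₀).symm u)
      (mfderiv 𝓘(ℝ, E) I (extChartAt I x₀).symm u v)
      (mfderiv 𝓘(ℝ, E) I (extChartAt I x₀).symm u w) := rfl

/-- The matrix `(g_{ij}(u))` of the metric in the preferred chart at `x₀`, with respect to the
linear coordinates of the model space given by the basis `Module.finBasis ℝ E`. -/
def metricMatrix (g : SmoothMetric I M) (x₀ : M) (u : E) :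
    Matrix (Fin (finrank ℝ E)) (Fin (finrank ℝ E)) ℝ :=
  Matrix.of fun i j ↦ metricInChart g x₀ u (finBasis ℝ E i) (finBasis ℝ E j)

/-- The Christoffel symbols of the Levi-Civita connection in the preferred chart at `x₀`, as a
vector-valued bilinear expression `Γ(v, w) = Γ^k_{ij} v^i w^j ∂_k`, where
`Γ^k_{ij} = ½ g^{kl} (∂_i g_{jl} + ∂_j g_{il} - ∂_l g_{ij})`. -/
def christoffel (g : SmoothMetric I M) (x₀ : M) (u v w : E) : E :=
  ∑ k, (1 / 2 * ∑ l, (metricMatrix g x₀ u)⁻¹ k l *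
    (fderiv ℝ (metricInChart g x₀) u v w (finBasis ℝ E l)
      + fderiv ℝ (metricInChart g x₀) u w v (finBasis ℝ E l)
      - fderiv ℝ (metricInChart g x₀) u (finBasis ℝ E l) v w)) • finBasis ℝ E k

/-- The second fundamental form `∇dφ` of a smooth map `φ : (M, g) → (N, h)` at `x`, computed in the
preferred charts at `x` and `φ x` (recall that Mathlib identifies the tangent space at a point
with the model space by means of the preferred chart at this point). In coordinates,
`(∇dφ)^α_{ij} = ∂_i ∂_j φ^α - Γ^k_{ij} ∂_k φ^α + Γ^α_{βγ} ∂_i φ^β ∂_j φ^γ`. -/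
def secondFundamentalForm (g : SmoothMetric I M) (h : SmoothMetric J N) (φ : M → N) (x : M)
    (v w : TangentSpace I x) : TangentSpace J (φ x) :=
  let u : E := extChartAt I x x
  let ψ : E → E' := writtenInExtChartAt I J x φ
  (fderiv ℝ (fderiv ℝ ψ) u v w - fderiv ℝ ψ u (christoffel g x u v w)
    + christoffel h (φ x) (ψ u) (fderiv ℝ ψ u v) (fderiv ℝ ψ u w) : E')

/-- The tension field `τ(φ) = Trace_g ∇dφ = g^{ij} (∇dφ)_{ij}`. -/
def tensionField (g : SmoothMetric I M) (h : SmoothMetric J N) (φ : M → N) (x : M) :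
    TangentSpace J (φ x) :=
  ∑ i, ∑ j, (metricMatrix g x (extChartAt I x x))⁻¹ i j •
    secondFundamentalForm g h φ x (finBasis ℝ E i) (finBasis ℝ E j)

/-- The bienergy `E²(φ, Ω) = ½ ∫_Ω |τ(φ)|² dvol`, where `vol` is the Riemannian volume of `g`. -/
def bienergy [MeasurableSpace M] (g : SmoothMetric I M) (vol : Measure M) (h : SmoothMetric J N)
    (φ : M → N) (Ω : Set M) : ℝ :=
  1 / 2 * ∫ x in Ω, h.inner (φ x) (tensionField g h φ x) (tensionField g h φ x) ∂vol

/-- A smooth map is harmonic if its tension field vanishes identically. -/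
def IsHarmonic (g : SmoothMetric I M) (h : SmoothMetric J N) (φ : M → N) : Prop :=
  ContMDiff I J ∞ φ ∧ ∀ x, tensionField g h φ x = 0

/-- A smooth map `φ : (M, g) → (N, h)` is biharmonic if it is a critical point of the bienergy on
every compact `Ω ⊆ M`: for each smooth variation `Φ_t` of `φ` supported in `Ω`, the function
`t ↦ E²(Φ_t, Ω)` has derivative `0` at `t = 0`. Here `vol` is the Riemannian volume of `g`. -/
def IsBiharmonic [MeasurableSpace M] (g : SmoothMetric I M) (vol : Measure M)
    (h : SmoothMetric J N) (φ : M → N) : Prop :=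
  ContMDiff I J ∞ φ ∧
    ∀ Ω : Set M, IsCompact Ω → ∀ Φ : ℝ → M → N,
      ContMDiff (𝓘(ℝ, ℝ).prod I) J ∞ (fun z : ℝ × M ↦ Φ z.1 z.2) → Φ 0 = φ →
      (∀ t, ∀ x ∉ Ω, Φ t x = φ x) →
      HasDerivAt (fun t ↦ bienergy g vol h (Φ t) Ω) 0 0

/-- A proper biharmonic map is a biharmonic map that is not harmonic. -/
def IsProperBiharmonic [MeasurableSpace M] (g : SmoothMetric I M) (vol : Measure M)
    (h : SmoothMetric J N) (φ : M → N) : Prop :=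
  IsBiharmonic g vol h φ ∧ ¬ IsHarmonic g h φ

end Tension

section Spheres

/-- The unit sphere `S^n` in `ℝ^{n+1}`. -/
abbrev Sphere (n : ℕ) : Type := Metric.sphere (0 : EuclideanSpace ℝ (Fin (n + 1))) 1

/-- The Riemannian volume (surface measure) of the round unit sphere `S^n`. -/
def sphereVolume (n : ℕ) : Measure (Sphere n) :=
  (volume : Measure (EuclideanSpace ℝ (Fin (n + 1)))).toSphere

/-- An orthogonal multiplication: a bilinear map `f` with `|f(x, y)| = |x| |y|`. -/
def IsOrthogonalMultiplication {p q n : ℕ}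
    (f : EuclideanSpace ℝ (Fin p) →ₗ[ℝ] EuclideanSpace ℝ (Fin q) →ₗ[ℝ]
      EuclideanSpace ℝ (Fin n)) : Prop :=
  ∀ x y, ‖f x y‖ = ‖x‖ * ‖y‖

/-- The map `ℝ^p × ℝ^q → ℝ^{n+1}`, `(x, y) ↦ (f(x, y) / √2, 1 / √2)`. -/
def liftedMap {p q n : ℕ}
    (f : EuclideanSpace ℝ (Fin p) →ₗ[ℝ] EuclideanSpace ℝ (Fin q) →ₗ[ℝ]
      EuclideanSpace ℝ (Fin n))
    (z : EuclideanSpace ℝ (Fin p) × EuclideanSpace ℝ (Fin q)) :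
    EuclideanSpace ℝ (Fin (n + 1)) :=
  WithLp.toLp 2 (Fin.snoc (α := fun _ ↦ ℝ) (fun i ↦ 1 / √2 * f z.1 z.2 i) (1 / √2))

end Spheres

end HarmonicMaps

end

open HarmonicMaps

/-!
Let `λ = k + l`, let `M` be the product of the two unit spheres, and let `Δ` be the Laplace operator
of `M`. For a map `Φ` from `M` to a unit sphere, viewed as a vector valued function, the tension
field is the tangential part `ΔΦ - ⟪ΔΦ, Φ⟫ Φ` of `ΔΦ`, so that
`|τ(Φ)|² = |ΔΦ|² - ⟪ΔΦ, Φ⟫²` (`inner_tensionField_self`). If `⟪Δφ, φ⟫ = -c` is constant, the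
derivative of the integrand along a variation with velocity `V` is
`2 ⟪Δφ + c φ, ΔV⟫ + 2 c ⟪Δφ, V⟫`. Since `Δ` is symmetric, `φ` is biharmonic as soon as
`Δ(Δφ + c φ) + c Δφ = 0` (`isBiharmonic_of_rotationLaplacian`). The map of the theorem is
`φ = B + e`, where `B = f / √2` is bilinear, `e = 1 / √2` in the last coordinate, and
`|B|² = |e|² = 1 / 2`. As `ΔB = -λ B` and `Δe = 0`, the equation holds with `c = λ / 2`, while
`|τ(φ)|² = λ² / 2 - λ² / 4 = λ² / 4` is not zero.

Two devices keep local computations short. First, `Δ` is written as the sum of the squares of the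
infinitesimal coordinate rotations of both factors (`rotationLaplacian`). The rotations preserve the
surface measures, so the symmetry of `Δ` is a change of variables followed by two differentiations
under the integral sign (`integral_inner_rotationLaplacian`). Second, the tension field is a
`g`-trace, and the velocities of the rotations form a tight frame of the tangent space. It is
therefore the sum of the covariant accelerations of the image curves of the rotation orbits, because
those of the orbits themselves add up to zero (`inner_tensionField`). The covariant acceleration of
a curve is the tangential part of its acceleration in the ambient space: this is the only place
where Christoffel symbols enter (`metricInChart_christoffel`, `inner_acceleration`).
-/

set_option linter.unusedSectionVars false

/-! ### Second derivatives along curves and first fundamental forms -/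

section Calculus

variable {E F : Type*} [NormedAddCommGroup E] [NormedSpace ℝ E]
  [NormedAddCommGroup F] [NormedSpace ℝ F]

theorem ContDiffAt.differentiableAt_fderiv {Ψ : E → F} {u : E} (hΨ : ContDiffAt ℝ ∞ Ψ u) :
    DifferentiableAt ℝ (fderiv ℝ Ψ) u :=
  (hΨ.fderiv_right (m := ∞) (by simp)).differentiableAt (by simp)

theorem ContDiffAt.eventually_differentiableAt {Ψ : E → F} {u : E} (hΨ : ContDiffAt ℝ ∞ Ψ u) :
    ∀ᶠ u' in 𝓝 u, DifferentiableAt ℝ Ψ u' := by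
  filter_upwards [(hΨ.of_le (m := 1) (by exact_mod_cast le_top)).eventually (by simp)] with r hr
  exact hr.differentiableAt (by simp)

/-- The second order chain rule along a curve. -/
theorem deriv_deriv_comp {Ψ : E → F} {c : ℝ → E} {s : ℝ} (hΨ : ContDiffAt ℝ ∞ Ψ (c s))
    (hc : ContDiffAt ℝ ∞ c s) :
    deriv (deriv (Ψ ∘ c)) s =
      fderiv ℝ (fderiv ℝ Ψ) (c s) (deriv c s) (deriv c s) +
        fderiv ℝ Ψ (c s) (deriv (deriv c) s) := by
  have hc1 := hc.eventually_differentiableAt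
  have e : deriv (Ψ ∘ c) =ᶠ[𝓝 s] fun r ↦ fderiv ℝ Ψ (c r) (deriv c r) := by
    filter_upwards [hc.continuousAt hΨ.eventually_differentiableAt, hc1] with r h1 h2
    exact (DifferentiableAt.hasFDerivAt h1).comp_hasDerivAt r h2.hasDerivAt |>.deriv
  have d2 : HasDerivAt (deriv c) (deriv (deriv c) s) s := by
    refine DifferentiableAt.hasDerivAt ?_
    have h := hc.differentiableAt_fderiv.clm_apply (differentiableAt_const (1 : ℝ))
    exact h.congr_of_eventuallyEq (.of_forall fun r ↦ by simp)
  rw [e.deriv_eq]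
  exact ((hΨ.differentiableAt_fderiv.hasFDerivAt.comp_hasDerivAt s
    hc1.self_of_nhds.hasDerivAt).clm_apply d2).deriv

/-- The differential of the first fundamental form `u ↦ ⟪dj_u ·, dj_u ·⟫` of a parametrization. -/
theorem fderiv_firstFundamentalForm {F : Type*} [NormedAddCommGroup F] [InnerProductSpace ℝ F]
    {j : E → F} {u : E} (hj : ContDiffAt ℝ ∞ j u) {b : E → E →L[ℝ] E →L[ℝ] ℝ}
    (hb : ∀ᶠ u' in 𝓝 u, ∀ v w, b u' v w = inner ℝ (fderiv ℝ j u' v) (fderiv ℝ j u' w))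
    (v w z : E) :
    fderiv ℝ b u v w z = inner ℝ (fderiv ℝ (fderiv ℝ j) u v w) (fderiv ℝ j u z) +
      inner ℝ (fderiv ℝ j u w) (fderiv ℝ (fderiv ℝ j) u v z) := by
  have d1 := hj.differentiableAt_fderiv
  have hB : DifferentiableAt ℝ b u := by
    have : DifferentiableAt ℝ (fun u' ↦ ((ContinuousLinearMap.compL ℝ E F ℝ).flip
        (fderiv ℝ j u')).comp ((innerSL ℝ).comp (fderiv ℝ j u'))) u :=
      ((ContinuousLinearMap.differentiableAt _).comp u d1).clm_comp
        ((differentiableAt_const _).clm_comp d1)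
    refine this.congr_of_eventuallyEq ?_
    filter_upwards [hb] with u' hu'
    ext v w
    simp [hu']
  have e1 : HasFDerivAt (fun u' ↦ b u' w z) _ u :=
    (hB.hasFDerivAt.clm_apply (hasFDerivAt_const w u)).clm_apply (hasFDerivAt_const z u)
  have e2 : HasFDerivAt (fun u' ↦ inner ℝ (fderiv ℝ j u' w) (fderiv ℝ j u' z)) _ u :=
    (d1.hasFDerivAt.clm_apply (hasFDerivAt_const w u)).inner ℝ
      (d1.hasFDerivAt.clm_apply (hasFDerivAt_const z u))
  have e3 := e1.unique (e2.congr_of_eventuallyEq (hb.mono fun u' hu' ↦ hu' w z))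
  have := DFunLike.congr_fun e3 v
  simpa [add_comm] using this

end Calculus

/-! ### Traces with respect to a bilinear form -/

section Trace

open scoped Matrix

/-- If the vectors `c a` form a tight frame for the form `b`, that is, `∑ b(c_a, ·)² = b`, then the
`b`-trace of a bilinear map is the sum of its values at the pairs `(c a, c a)`. The reason is that
`Cᵀ C` inverts the Gram matrix if `C` is the matrix of coordinates of the `c a`. -/
theorem sum_inv_gram_smul_eq {E V ι κ : Type*} [AddCommGroup E] [Module ℝ E] [AddCommGroup V]
    [Module ℝ V] [Fintype ι] [DecidableEq ι] [Fintype κ] (e : Basis ι ℝ E)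
    (b : LinearMap.BilinForm ℝ E)
    (hb : IsUnit (Matrix.of fun i j ↦ b (e i) (e j)).det)
    (B : E →ₗ[ℝ] E →ₗ[ℝ] V) (c : κ → E)
    (hc : ∀ v w, ∑ a, b (c a) v * b (c a) w = b v w) :
    ∑ i, ∑ j, (Matrix.of fun i j ↦ b (e i) (e j))⁻¹ i j • B (e i) (e j) =
      ∑ a, B (c a) (c a) := by
  set G : Matrix ι ι ℝ := Matrix.of fun i j ↦ b (e i) (e j) with hG
  set C : Matrix κ ι ℝ := Matrix.of fun a i ↦ e.repr (c a) i with hC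
  have hbc : ∀ a j, b (c a) (e j) = (C * G) a j := by
    intro a j
    conv_lhs => rw [← e.sum_repr (c a)]
    simp [Matrix.mul_apply, hG, hC, -Basis.sum_repr, LinearMap.sum_apply]
  have h1 : (C * G)ᵀ * (C * G) = G := by
    ext i j
    rw [Matrix.mul_apply]
    simp only [Matrix.transpose_apply, ← hbc]
    exact hc (e i) (e j)
  have h2 : Gᵀ * (Cᵀ * C) = 1 := by
    have : (Gᵀ * (Cᵀ * C)) * G = 1 * G := by
      rw [one_mul]; conv_rhs => rw [← h1]
      rw [Matrix.transpose_mul]; simp only [Matrix.mul_assoc]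
    have := congrArg (· * G⁻¹) this
    simpa only [Matrix.mul_assoc, Matrix.mul_nonsing_inv _ hb, Matrix.mul_one] using this
  have h3 : G⁻¹ = Cᵀ * C := by
    have h4 : (Cᵀ * C) * G = 1 := by
      have := congrArg Matrix.transpose h2
      simpa [Matrix.transpose_mul] using this
    exact Matrix.inv_eq_left_inv h4
  have h5 : ∀ a, B (c a) (c a) = ∑ i, ∑ j, (C a i * C a j) • B (e i) (e j) := by
    intro a
    conv_lhs => rw [← e.sum_repr (c a)]
    simp only [hC, mul_smul, Finset.smul_sum, map_sum, map_smul, LinearMap.sum_apply,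
      LinearMap.smul_apply, Matrix.of_apply]
    rw [Finset.sum_comm]
    exact Finset.sum_congr rfl fun i _ ↦ Finset.sum_congr rfl fun j _ ↦ smul_comm _ _ _
  simp_rw [h5, h3, Matrix.mul_apply, Matrix.transpose_apply, Finset.sum_smul]
  rw [Finset.sum_comm]
  conv_rhs => rw [Finset.sum_comm]
  conv_lhs => rw [Finset.sum_comm]
  refine Finset.sum_congr rfl fun i _ ↦ ?_
  rw [Finset.sum_comm]

end Trace

/-! ### Christoffel symbols of an induced metric -/

section Christoffel

variable {E : Type*} [NormedAddCommGroup E] [NormedSpace ℝ E] [FiniteDimensional ℝ E]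
  {H : Type*} [TopologicalSpace H] {I : ModelWithCorners ℝ E H} [I.Boundaryless]
  {M : Type*} [TopologicalSpace M] [ChartedSpace H M] [IsManifold I ∞ M]
  {F : Type*} [NormedAddCommGroup F] [InnerProductSpace ℝ F]

/-- A smooth map `ι` into an inner product space that induces the metric `g`. -/
structure IsIsometricImmersion (g : SmoothMetric I M) (ι : M → F) : Prop where
  contMDiff : ContMDiff I 𝓘(ℝ, F) ∞ ι
  inner_eq : ∀ (x : M) (v w : TangentSpace I x),
    g.inner x v w = inner ℝ (mvfderiv I ι x v) (mvfderiv I ι x w)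

variable {g : SmoothMetric I M} {ι : M → F}

theorem contDiffAt_comp_extChartAt_symm (hι : ContMDiff I 𝓘(ℝ, F) ∞ ι) (x : M) :
    ContDiffAt ℝ ∞ (ι ∘ (extChartAt I x).symm) (extChartAt I x x) := by
  have h1 : ContMDiffAt 𝓘(ℝ, E) I ∞ (extChartAt I x).symm (extChartAt I x x) :=
    (contMDiffOn_extChartAt_symm x).contMDiffAt (extChartAt_target_mem_nhds x)
  exact (hι.contMDiffAt.comp _ h1).contDiffAt

/-- The preferred chart at `x` identifies the tangent space at `x` with the model space, so the
differential of `ι` at `x` is the derivative of `ι` read in this chart. -/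
theorem fderiv_comp_extChartAt_symm (hι : ContMDiff I 𝓘(ℝ, F) ∞ ι) (x : M) :
    fderiv ℝ (ι ∘ (extChartAt I x).symm) (extChartAt I x x) =
      (mvfderiv I ι x : TangentSpace I x →L[ℝ] F) := by
  ext v
  rw [(hι.contMDiffAt.mdifferentiableAt (by simp)).mvfderiv]
  simp [I.range_eq_univ]
  rfl

/-- In the chart at `x`, the metric is the first fundamental form of the parametrization
`ι ∘ (extChartAt I x).symm`. -/
theorem metricInChart_eventually (hg : IsIsometricImmersion g ι) (x : M) :
    ∀ᶠ u in 𝓝 (extChartAt I x x), ∀ v w, metricInChart g x u v w =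
      inner ℝ (fderiv ℝ (ι ∘ (extChartAt I x).symm) u v)
        (fderiv ℝ (ι ∘ (extChartAt I x).symm) u w) := by
  filter_upwards [extChartAt_target_mem_nhds (I := I) x] with u hu v w
  have h1 : ContMDiffAt 𝓘(ℝ, E) I ∞ (extChartAt I x).symm u :=
    (contMDiffOn_extChartAt_symm x).contMDiffAt ((isOpen_extChartAt_target x).mem_nhds hu)
  have h2 : ∀ v, fderiv ℝ (ι ∘ (extChartAt I x).symm) u v =
      mvfderiv I ι ((extChartAt I x).symm u)
        (mfderiv 𝓘(ℝ, E) I (extChartAt I x).symm u v) := by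
    intro v
    rw [← mfderiv_eq_fderiv, mfderiv_comp (I' := I) u
      (hg.contMDiff.contMDiffAt.mdifferentiableAt (by simp)) (h1.mdifferentiableAt (by simp))]
    rfl
  rw [metricInChart_apply, hg.inner_eq, h2, h2]

theorem metricInChart_self (hg : IsIsometricImmersion g ι) (x : M) (v w : E) :
    metricInChart g x (extChartAt I x x) v w = g.inner x v w := by
  rw [(metricInChart_eventually hg x).self_of_nhds, fderiv_comp_extChartAt_symm hg.contMDiff]
  exact (hg.inner_eq x v w).symm

theorem eq_zero_of_inner_self {x : M} {v : TangentSpace I x} (h : g.inner x v v = 0) : v = 0 := by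
  by_contra hv
  exact (g.pos x v hv).ne' h

theorem isUnit_det_metricMatrix (hg : IsIsometricImmersion g ι) (x : M) :
    IsUnit (metricMatrix g x (extChartAt I x x)).det := by
  rw [isUnit_iff_ne_zero]
  intro h
  obtain ⟨a, ha, h0⟩ := Matrix.exists_mulVec_eq_zero_iff.2 h
  refine ha (funext fun i ↦ ?_)
  set v : E := ∑ i, a i • finBasis ℝ E i with hv
  have h1 : g.inner x (v : TangentSpace I x) v = 0 := by
    rw [← metricInChart_self hg]
    have : metricInChart g x (extChartAt I x x) v v =
        a ⬝ᵥ ((metricMatrix g x (extChartAt I x x)).mulVec a) := by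
      simp only [hv, map_sum, map_smul, sum_apply, smul_apply,
        dotProduct, Matrix.mulVec, metricMatrix, Matrix.of_apply, smul_eq_mul, Finset.mul_sum]
      rw [Finset.sum_comm]
      exact Finset.sum_congr rfl fun i _ ↦ Finset.sum_congr rfl fun j _ ↦ by ring
    rw [this, h0, dotProduct_zero]
  have h2 : v = 0 := eq_zero_of_inner_self h1
  exact Fintype.linearIndependent_iff.1 (finBasis ℝ E).linearIndependent a h2 i

/-- The Christoffel symbols of an induced metric give the tangential part of the second derivative
of the parametrization. -/
theorem metricInChart_christoffel (hg : IsIsometricImmersion g ι) (x : M) (v w z : E) :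
    metricInChart g x (extChartAt I x x) (christoffel g x (extChartAt I x x) v w) z =
      inner ℝ (fderiv ℝ (fderiv ℝ (ι ∘ (extChartAt I x).symm)) (extChartAt I x x) v w)
        (fderiv ℝ (ι ∘ (extChartAt I x).symm) (extChartAt I x x) z) := by
  have hj := contDiffAt_comp_extChartAt_symm hg.contMDiff x
  have hb := metricInChart_eventually hg x
  set j := ι ∘ (extChartAt I x).symm
  set u := extChartAt I x x
  set G := metricMatrix g x u with hG
  have hsymm : ∀ a b, fderiv ℝ (fderiv ℝ j) u a b = fderiv ℝ (fderiv ℝ j) u b a := fun a b ↦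
    (hj.isSymmSndFDerivAt (by
      simp only [minSmoothness_of_isRCLikeNormedField]
      exact WithTop.coe_le_coe.2 le_top)) a b
  have hGs : ∀ a b, G a b = G b a := fun a b ↦ by
    simp only [hG, metricMatrix, Matrix.of_apply, hb.self_of_nhds]
    exact real_inner_comm _ _
  suffices h : (metricInChart g x u (christoffel g x u v w) : E →ₗ[ℝ] ℝ) =
      (innerSL ℝ (fderiv ℝ (fderiv ℝ j) u v w)).comp (fderiv ℝ j u) from
    LinearMap.congr_fun h z
  refine (finBasis ℝ E).ext fun m ↦ ?_
  -- the Koszul expression collapses by the symmetry of the second derivative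
  have hK : ∀ z, fderiv ℝ (metricInChart g x) u v w z + fderiv ℝ (metricInChart g x) u w v z -
      fderiv ℝ (metricInChart g x) u z v w =
      2 * inner ℝ (fderiv ℝ (fderiv ℝ j) u v w) (fderiv ℝ j u z) := by
    intro z
    simp only [fderiv_firstFundamentalForm hj hb]
    rw [hsymm w v, hsymm z v, hsymm z w,
      real_inner_comm (fderiv ℝ (fderiv ℝ j) u v z) (fderiv ℝ j u w)]
    ring
  simp only [christoffel, hK, ContinuousLinearMap.coe_coe, map_sum, map_smul, sum_apply,
    smul_apply, smul_eq_mul]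
  have hGG := Matrix.mul_nonsing_inv G (isUnit_det_metricMatrix hg x)
  set q : Fin (finrank ℝ E) → ℝ := fun l ↦
    inner ℝ (fderiv ℝ (fderiv ℝ j) u v w) (fderiv ℝ j u (finBasis ℝ E l)) with hq
  calc ∑ k, (1 / 2 * ∑ l, G⁻¹ k l * (2 * q l)) * G k m
      = (G.mulVec (G⁻¹.mulVec q)) m := by
        simp only [Matrix.mulVec, dotProduct, Finset.mul_sum, Finset.sum_mul]
        exact Finset.sum_congr rfl fun i _ ↦ Finset.sum_congr rfl fun k _ ↦ by
          rw [hGs i m]; ring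
    _ = q m := by rw [Matrix.mulVec_mulVec, hGG, Matrix.one_mulVec]

/-- The covariant acceleration of a curve, computed in the chart at its initial point, is the
tangential part of its acceleration in the ambient space. -/
theorem inner_acceleration (hg : IsIsometricImmersion g ι) (x : M) {η : ℝ → E}
    (hη : ContDiffAt ℝ ∞ η 0) (h0 : η 0 = extChartAt I x x) (z : E) :
    metricInChart g x (extChartAt I x x)
        (deriv (deriv η) 0 + christoffel g x (extChartAt I x x) (deriv η 0) (deriv η 0)) z =
      inner ℝ (deriv (deriv ((ι ∘ (extChartAt I x).symm) ∘ η)) 0)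
        (fderiv ℝ (ι ∘ (extChartAt I x).symm) (extChartAt I x x) z) := by
  have hj := contDiffAt_comp_extChartAt_symm hg.contMDiff x
  rw [← h0] at hj
  rw [deriv_deriv_comp hj hη, inner_add_left, h0, map_add, add_apply,
    metricInChart_christoffel hg, add_comm, (metricInChart_eventually hg x).self_of_nhds]

end Christoffel

/-! ### The tension field of a map between isometrically immersed manifolds -/

section Tension

variable {E : Type*} [NormedAddCommGroup E] [NormedSpace ℝ E] [FiniteDimensional ℝ E]
  {H : Type*} [TopologicalSpace H] {I : ModelWithCorners ℝ E H} [I.Boundaryless]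
  {M : Type*} [TopologicalSpace M] [ChartedSpace H M] [IsManifold I ∞ M]
  {F : Type*} [NormedAddCommGroup F] [InnerProductSpace ℝ F]
  {E' : Type*} [NormedAddCommGroup E'] [NormedSpace ℝ E'] [FiniteDimensional ℝ E']
  {H' : Type*} [TopologicalSpace H'] {J : ModelWithCorners ℝ E' H'} [J.Boundaryless]
  {N : Type*} [TopologicalSpace N] [ChartedSpace H' N] [IsManifold J ∞ N]
  {F' : Type*} [NormedAddCommGroup F'] [InnerProductSpace ℝ F']
  {g : SmoothMetric I M} {ι : M → F} {h : SmoothMetric J N} {ι' : N → F'}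

theorem christoffel_add_left (g : SmoothMetric I M) (x : M) (u v v' w : E) :
    christoffel g x u (v + v') w = christoffel g x u v w + christoffel g x u v' w := by
  rw [christoffel, christoffel, christoffel, ← Finset.sum_add_distrib]
  refine Finset.sum_congr rfl fun k _ ↦ ?_
  rw [← add_smul, ← mul_add, ← Finset.sum_add_distrib]
  congr 2
  refine Finset.sum_congr rfl fun l _ ↦ ?_
  rw [ContinuousLinearMap.map_add, ContinuousLinearMap.map_add, ContinuousLinearMap.map_add]
  simp only [add_apply]
  ring

theorem christoffel_smul_left (g : SmoothMetric I M) (x : M) (u : E) (r : ℝ) (v w : E) :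
    christoffel g x u (r • v) w = r • christoffel g x u v w := by
  rw [christoffel, christoffel, Finset.smul_sum]
  refine Finset.sum_congr rfl fun k _ ↦ ?_
  rw [smul_smul, mul_left_comm, Finset.mul_sum (a := r)]
  congr 2
  refine Finset.sum_congr rfl fun l _ ↦ ?_
  rw [ContinuousLinearMap.map_smul, ContinuousLinearMap.map_smul, ContinuousLinearMap.map_smul]
  simp only [smul_apply, smul_eq_mul]
  ring

theorem christoffel_add_right (g : SmoothMetric I M) (x : M) (u v w w' : E) :
    christoffel g x u v (w + w') = christoffel g x u v w + christoffel g x u v w' := by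
  rw [christoffel, christoffel, christoffel, ← Finset.sum_add_distrib]
  refine Finset.sum_congr rfl fun k _ ↦ ?_
  rw [← add_smul, ← mul_add, ← Finset.sum_add_distrib]
  congr 2
  refine Finset.sum_congr rfl fun l _ ↦ ?_
  rw [ContinuousLinearMap.map_add, ContinuousLinearMap.map_add, ContinuousLinearMap.map_add]
  simp only [add_apply]
  ring

theorem christoffel_smul_right (g : SmoothMetric I M) (x : M) (u : E) (r : ℝ) (v w : E) :
    christoffel g x u v (r • w) = r • christoffel g x u v w := by
  rw [christoffel, christoffel, Finset.smul_sum]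
  refine Finset.sum_congr rfl fun k _ ↦ ?_
  rw [smul_smul, mul_left_comm, Finset.mul_sum (a := r)]
  congr 2
  refine Finset.sum_congr rfl fun l _ ↦ ?_
  rw [ContinuousLinearMap.map_smul, ContinuousLinearMap.map_smul, ContinuousLinearMap.map_smul]
  simp only [smul_apply, smul_eq_mul]
  ring

/-- The Christoffel symbols as a bilinear map. -/
noncomputable def christoffelBilin (g : SmoothMetric I M) (x : M) (u : E) : E →ₗ[ℝ] E →ₗ[ℝ] E :=
  LinearMap.mk₂ ℝ (christoffel g x u) (christoffel_add_left g x u) (christoffel_smul_left g x u)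
    (christoffel_add_right g x u) (christoffel_smul_right g x u)

/-- The second fundamental form at `x` as a bilinear map on the model space, which is the tangent
space at `x`. -/
noncomputable def secondFundamentalBilin (g : SmoothMetric I M) (h : SmoothMetric J N)
    (φ : M → N) (x : M) : E →ₗ[ℝ] E →ₗ[ℝ] E' :=
  let u : E := extChartAt I x x
  let ψ : E → E' := writtenInExtChartAt I J x φ
  (fderiv ℝ (fderiv ℝ ψ) u).toLinearMap₁₂ - (christoffelBilin g x u).compr₂ (fderiv ℝ ψ u)
    + (christoffelBilin h (φ x) (ψ u)).compl₁₂ (fderiv ℝ ψ u : E →ₗ[ℝ] E')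
      (fderiv ℝ ψ u : E →ₗ[ℝ] E')

/-- The tension field of `Φ` in the ambient space: if the curves `γ a` through `x` have velocities
forming a tight frame of the tangent space and accelerations adding up to a normal vector, the
tension field is the tangential part of the sum of the accelerations of the curves `Φ ∘ γ a`. -/
theorem inner_tensionField (hg : IsIsometricImmersion g ι) (hh : IsIsometricImmersion h ι')
    {Φ : M → N} (hΦ : ContMDiff I J ∞ Φ) {x : M} {κ : Type*} [Fintype κ] {γ : κ → ℝ → M}
    (hγ : ∀ a, ContMDiff 𝓘(ℝ, ℝ) I ∞ (γ a)) (hγ0 : ∀ a, γ a 0 = x)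
    (hframe : ∀ v w : TangentSpace I x,
      ∑ a, inner ℝ (deriv (ι ∘ γ a) 0) (mvfderiv I ι x v) *
        inner ℝ (deriv (ι ∘ γ a) 0) (mvfderiv I ι x w) = g.inner x v w)
    (hacc : ∀ v : TangentSpace I x,
      inner ℝ (∑ a, deriv (deriv (ι ∘ γ a)) 0) (mvfderiv I ι x v) = 0)
    (z : TangentSpace J (Φ x)) :
    h.inner (Φ x) (tensionField g h Φ x) z =
      inner ℝ (∑ a, deriv (deriv (ι' ∘ Φ ∘ γ a)) 0) (mvfderiv J ι' (Φ x) z) := by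
  set u : E := extChartAt I x x with hu
  set ψ : E → E' := writtenInExtChartAt I J x Φ with hψ
  set c : κ → ℝ → E := fun a ↦ extChartAt I x ∘ γ a with hc
  have hc0 : ∀ a, c a 0 = u := fun a ↦ by simp [hc, hγ0, hu]
  have hcs : ∀ a, ContDiffAt ℝ ∞ (c a) 0 := fun a ↦ by
    have h1 : ContMDiffAt I 𝓘(ℝ, E) ∞ (extChartAt I x) (γ a 0) := by
      rw [hγ0]; exact contMDiffAt_extChartAt
    exact (h1.comp 0 (hγ a).contMDiffAt).contDiffAt
  have hψs : ContDiffAt ℝ ∞ ψ u := by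
    have := (contMDiffAt_iff.1 (hΦ.contMDiffAt (x := x))).2
    rw [I.range_eq_univ, contDiffWithinAt_univ] at this
    exact this
  -- reading the curves in the charts is harmless, as only their germs at `0` matter
  have hsrc : ∀ a, ∀ᶠ s in 𝓝 (0 : ℝ), γ a s ∈ (extChartAt I x).source := fun a ↦
    (hγ a).continuous.continuousAt.eventually_mem
      (by rw [hγ0]; exact extChartAt_source_mem_nhds x)
  have hsrc' : ∀ a, ∀ᶠ s in 𝓝 (0 : ℝ), Φ (γ a s) ∈ (extChartAt J (Φ x)).source := fun a ↦
    (hΦ.continuous.comp (hγ a).continuous).continuousAt.eventually_mem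
      (by simp only [Function.comp_apply, hγ0]; exact extChartAt_source_mem_nhds _)
  have hιc : ∀ a, ((ι ∘ (extChartAt I x).symm) ∘ c a) =ᶠ[𝓝 0] ι ∘ γ a := fun a ↦ by
    filter_upwards [hsrc a] with s hs
    simp only [hc, Function.comp_apply, (extChartAt I x).left_inv hs]
  have hιψ : ∀ a, ((ι' ∘ (extChartAt J (Φ x)).symm) ∘ (ψ ∘ c a)) =ᶠ[𝓝 0] ι' ∘ Φ ∘ γ a := fun a ↦ by
    filter_upwards [hsrc a, hsrc' a] with s hs hs'
    simp only [hc, hψ, writtenInExtChartAt, Function.comp_apply, (extChartAt I x).left_inv hs,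
      (extChartAt J (Φ x)).left_inv hs']
  have hvel : ∀ a, deriv (ι ∘ γ a) 0 = mvfderiv I ι x (deriv (c a) 0) := fun a ↦ by
    rw [← (hιc a).deriv_eq, ← fderiv_comp_extChartAt_symm hg.contMDiff, ← hu, ← hc0 a]
    refine HasDerivAt.deriv (HasFDerivAt.comp_hasDerivAt 0 (DifferentiableAt.hasFDerivAt ?_)
      ((hcs a).differentiableAt (by simp)).hasDerivAt)
    rw [hc0]
    exact (contDiffAt_comp_extChartAt_symm hg.contMDiff x).differentiableAt (by simp)
  -- the covariant accelerations of the curves `γ a` cancel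
  have hΓ : ∑ a, (deriv (deriv (c a)) 0 + christoffel g x u (deriv (c a) 0) (deriv (c a) 0)) =
      0 := by
    have key : ∀ z : E, metricInChart g x u (∑ a, (deriv (deriv (c a)) 0 +
        christoffel g x u (deriv (c a) 0) (deriv (c a) 0))) z = 0 := by
      intro z
      refine Eq.trans ?_ (hacc z)
      rw [sum_inner, map_sum, sum_apply]
      refine Finset.sum_congr rfl fun a _ ↦ ?_
      rw [inner_acceleration hg x (hcs a) (hc0 a) z, ((hιc a).deriv).deriv_eq,
        fderiv_comp_extChartAt_symm hg.contMDiff]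
      rfl
    exact eq_zero_of_inner_self (g := g) (x := x) ((metricInChart_self hg x _ _).symm.trans (key _))
  have hψ0 : ψ u = extChartAt J (Φ x) (Φ x) := by simp [hψ, hu, writtenInExtChartAt]
  -- the tension field as a sum of covariant accelerations
  have hframe' : ∀ v w : E, ∑ a, metricInChart g x u (deriv (c a) 0) v *
      metricInChart g x u (deriv (c a) 0) w = metricInChart g x u v w := by
    intro v w
    have h1 := fun a v ↦ (metricInChart_self hg x (deriv (c a) 0) v).trans
      (hg.inner_eq x (deriv (c a) 0) v)
    simp_rw [hu, h1]
    refine Eq.trans ?_ ((hframe v w).trans (metricInChart_self hg x v w).symm)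
    simp_rw [hvel]
  have hτ : tensionField g h Φ x = ∑ a, (deriv (deriv (ψ ∘ c a)) 0 +
      christoffel h (Φ x) (ψ u) (deriv (ψ ∘ c a) 0) (deriv (ψ ∘ c a) 0)) := by
    have h1 := sum_inv_gram_smul_eq (finBasis ℝ E) (metricInChart g x u).toLinearMap₁₂
      (isUnit_det_metricMatrix hg x) (secondFundamentalBilin g h Φ x) (fun a ↦ deriv (c a) 0)
      hframe'
    refine h1.trans ?_
    have h2 : ∀ a, deriv (ψ ∘ c a) 0 = fderiv ℝ ψ u (deriv (c a) 0) := fun a ↦ by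
      rw [← hc0 a] at hψs ⊢
      exact ((hψs.differentiableAt (by simp)).hasFDerivAt.comp_hasDerivAt 0
        ((hcs a).differentiableAt (by simp)).hasDerivAt).deriv
    have h3 : ∀ a, deriv (deriv (ψ ∘ c a)) 0 =
        fderiv ℝ (fderiv ℝ ψ) u (deriv (c a) 0) (deriv (c a) 0) +
          fderiv ℝ ψ u (deriv (deriv (c a)) 0) := fun a ↦ by
      rw [← hc0 a] at hψs ⊢
      exact deriv_deriv_comp hψs (hcs a)
    -- `dψ` applied to `hΓ` trades the Christoffel symbols of `g` for the accelerations of `c a`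
    have h4 := congrArg (fderiv ℝ ψ u) hΓ
    rw [map_sum, map_zero] at h4
    have h5 : ∀ v : E, secondFundamentalBilin g h Φ x v v = fderiv ℝ (fderiv ℝ ψ) u v v -
        fderiv ℝ ψ u (christoffel g x u v v) +
        christoffel h (Φ x) (ψ u) (fderiv ℝ ψ u v) (fderiv ℝ ψ u v) := fun v ↦ rfl
    rw [← sub_eq_zero, ← Finset.sum_sub_distrib, ← neg_eq_zero, ← h4, ← Finset.sum_neg_distrib]
    refine Finset.sum_congr rfl fun a _ ↦ ?_
    rw [h5, h3, h2, map_add]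
    abel
  rw [hτ]
  refine (metricInChart_self hh (Φ x) _ z).symm.trans ?_
  rw [sum_inner, map_sum]
  refine (sum_apply _ _ _).trans (Finset.sum_congr rfl fun a _ ↦ ?_)
  have hs : ContDiffAt ℝ ∞ (ψ ∘ c a) 0 := ContDiffAt.comp 0 (by rwa [hc0]) (hcs a)
  have h0 : (ψ ∘ c a) 0 = extChartAt J (Φ x) (Φ x) := (congrArg ψ (hc0 a)).trans hψ0
  have h1 := inner_acceleration hh (Φ x) hs h0 z
  rw [((hιψ a).deriv).deriv_eq, fderiv_comp_extChartAt_symm hh.contMDiff] at h1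
  rw [hψ0]
  exact h1

end Tension

/-! ### Smooth functions depending on a real parameter -/

section Parametric

variable {E : Type*} [NormedAddCommGroup E] [NormedSpace ℝ E]
  {H : Type*} [TopologicalSpace H] {I : ModelWithCorners ℝ E H}
  {P : Type*} [TopologicalSpace P] [ChartedSpace H P]
  {F : Type*} [NormedAddCommGroup F] [NormedSpace ℝ F]

/-- The partial derivative of a smooth function in a real variable is smooth. -/
theorem ContMDiff.partialDeriv [IsManifold I ∞ P] {G : ℝ → P → F}
    (hG : ContMDiff (𝓘(ℝ, ℝ).prod I) 𝓘(ℝ, F) ∞ (fun z : ℝ × P ↦ G z.1 z.2)) :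
    ContMDiff (𝓘(ℝ, ℝ).prod I) 𝓘(ℝ, F) ∞ (fun z : ℝ × P ↦ deriv (fun s ↦ G s z.2) z.1) := by
  intro z₀
  have h1 : ContMDiffAt ((𝓘(ℝ, ℝ).prod I).prod 𝓘(ℝ, ℝ)) 𝓘(ℝ, F) ∞
      (Function.uncurry fun (z : ℝ × P) (s : ℝ) ↦ G s z.2) (z₀, z₀.1) :=
    (hG.comp (contMDiff_snd.prodMk (contMDiff_snd.comp contMDiff_fst))).contMDiffAt
  have h2 := ContMDiffAt.mfderiv (fun (z : ℝ × P) (s : ℝ) ↦ G s z.2) Prod.fst h1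
    (contMDiff_fst.contMDiffAt) (m := ∞) (by simp)
  have h3 : ContMDiffAt (𝓘(ℝ, ℝ).prod I) 𝓘(ℝ, ℝ →L[ℝ] F) ∞
      (fun z : ℝ × P ↦ fderiv ℝ (fun s ↦ G s z.2) z.1) z₀ := by
    refine h2.congr_of_eventuallyEq (.of_forall fun z ↦ ?_)
    have e := inTangentCoordinates_model_space (I := 𝓘(ℝ, ℝ)) (I' := 𝓘(ℝ, F))
      (Prod.fst : ℝ × P → ℝ) (fun z ↦ G z.1 z.2)
      (fun z ↦ mfderiv 𝓘(ℝ, ℝ) 𝓘(ℝ, F) (fun s ↦ G s z.2) z.1) z₀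
    exact (mfderiv_eq_fderiv.symm).trans (congrFun e z).symm
  refine (h3.clm_apply (contMDiffAt_const (c := (1 : ℝ)))).congr_of_eventuallyEq
    (.of_forall fun z ↦ ?_)
  exact (fderiv_apply_one_eq_deriv).symm

theorem ContMDiff.hasDerivAt_partial {G : ℝ → P → F}
    (hG : ContMDiff (𝓘(ℝ, ℝ).prod I) 𝓘(ℝ, F) ∞ (fun z : ℝ × P ↦ G z.1 z.2)) (s : ℝ) (p : P) :
    HasDerivAt (fun s ↦ G s p) (deriv (fun s ↦ G s p) s) s := by
  have h : ContMDiff 𝓘(ℝ, ℝ) 𝓘(ℝ, F) ∞ (fun s ↦ G s p) :=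
    hG.comp (contMDiff_id.prodMk contMDiff_const)
  exact (h.contDiff.differentiable (by simp) s).hasDerivAt

/-- Differentiation under the integral sign over a compact manifold. -/
theorem ContMDiff.hasDerivAt_integral [IsManifold I ∞ P] [CompactSpace P] [MeasurableSpace P]
    [BorelSpace P] [SecondCountableTopology P] {μ : Measure P} [IsFiniteMeasure μ] {G : ℝ → P → ℝ}
    (hG : ContMDiff (𝓘(ℝ, ℝ).prod I) 𝓘(ℝ, ℝ) ∞ (fun z : ℝ × P ↦ G z.1 z.2)) (s₀ : ℝ) :
    HasDerivAt (fun s ↦ ∫ p, G s p ∂μ) (∫ p, deriv (fun s ↦ G s p) s₀ ∂μ) s₀ := by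
  have hc : ∀ s, Continuous (G s) := fun s ↦
    hG.continuous.comp (Continuous.prodMk continuous_const continuous_id)
  have hG' := hG.partialDeriv.continuous
  have hc' : ∀ s, Continuous (fun p ↦ deriv (fun s ↦ G s p) s) := fun s ↦
    hG'.comp (Continuous.prodMk continuous_const continuous_id)
  obtain ⟨C, hC⟩ := ((isCompact_closedBall s₀ 1).prod (isCompact_univ
    (X := P))).exists_bound_of_continuousOn hG'.continuousOn
  have hint : Integrable (G s₀) μ := by
    obtain ⟨D, hD⟩ := (isCompact_univ (X := P)).exists_bound_of_continuousOn (hc s₀).continuousOn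
    exact Integrable.of_bound (hc s₀).aestronglyMeasurable D (.of_forall fun p ↦ hD p trivial)
  exact (hasDerivAt_integral_of_dominated_loc_of_deriv_le (bound := fun _ ↦ C)
    (Metric.closedBall_mem_nhds s₀ one_pos)
    (.of_forall fun s ↦ (hc s).aestronglyMeasurable) hint
    (F' := fun s p ↦ deriv (fun s ↦ G s p) s) (hc' s₀).aestronglyMeasurable
    (.of_forall fun p s hs ↦ hC (s, p) ⟨hs, trivial⟩) (integrable_const C)
    (.of_forall fun p s _ ↦ hG.hasDerivAt_partial s p)).2

end Parametric

/-! ### Rotations of the sphere and the surface measure -/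

section SphereMeasure

open scoped Pointwise

/-- A linear isometry acting on the unit sphere. -/
def LinearIsometryEquiv.onSphere {V : Type*} [NormedAddCommGroup V] [NormedSpace ℝ V]
    (L : V ≃ₗᵢ[ℝ] V) (x : Metric.sphere (0 : V) 1) : Metric.sphere (0 : V) 1 :=
  ⟨L x, by simp⟩

theorem LinearIsometryEquiv.continuous_onSphere {V : Type*} [NormedAddCommGroup V] [NormedSpace ℝ V]
    (L : V ≃ₗᵢ[ℝ] V) : Continuous L.onSphere :=
  (L.continuous.comp continuous_subtype_val).subtype_mk _

theorem LinearIsometryEquiv.measurePreserving_onSphere {V : Type*} [NormedAddCommGroup V]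
    [InnerProductSpace ℝ V] [FiniteDimensional ℝ V] [MeasurableSpace V] [BorelSpace V]
    (L : V ≃ₗᵢ[ℝ] V) :
    MeasurePreserving L.onSphere (volume : Measure V).toSphere (volume : Measure V).toSphere := by
  refine ⟨L.continuous_onSphere.measurable, Measure.ext fun s hs ↦ ?_⟩
  rw [Measure.map_apply L.continuous_onSphere.measurable hs,
    Measure.toSphere_apply' _ (L.continuous_onSphere.measurable hs), Measure.toSphere_apply' _ hs]
  congr 1
  have : (Ioo (0 : ℝ) 1 • ((↑) '' (L.onSphere ⁻¹' s)) : Set V) =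
      L ⁻¹' (Ioo (0 : ℝ) 1 • ((↑) '' s)) := by
    ext v
    simp only [Set.mem_smul, mem_image, mem_preimage]
    constructor
    · rintro ⟨r, hr, _, ⟨x, hx, rfl⟩, rfl⟩
      exact ⟨r, hr, _, ⟨_, hx, rfl⟩, by simp [LinearIsometryEquiv.onSphere]⟩
    · rintro ⟨r, hr, _, ⟨x, hx, rfl⟩, h⟩
      refine ⟨r, hr, _, ⟨L.symm.onSphere x, ?_, rfl⟩, ?_⟩
      · simpa [LinearIsometryEquiv.onSphere] using hx
      · apply L.injective
        simpa [LinearIsometryEquiv.onSphere] using h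
  rw [this]
  exact (L.measurePreserving).measure_preimage_emb L.toMeasurableEquiv.measurableEmbedding _

end SphereMeasure

section Rotations

variable {V : Type*} [NormedAddCommGroup V] [InnerProductSpace ℝ V] [FiniteDimensional ℝ V]

theorem exp_smul_mem_unitary {A : V →L[ℝ] V} (hA : A ∈ skewAdjoint (V →L[ℝ] V)) (s : ℝ) :
    NormedSpace.exp (s • A) ∈ unitary (V →L[ℝ] V) :=
  let _ : NormedAlgebra ℚ (V →L[ℝ] V) := .restrictScalars ℚ ℝ _
  NormedSpace.exp_mem_unitary_of_mem_skewAdjoint ((skewAdjoint.smul_mem s hA))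

/-- The one-parameter group `s ↦ exp (s A)` of rotations generated by a skew operator `A`. -/
noncomputable def expRotation (A : skewAdjoint (V →L[ℝ] V)) (s : ℝ) : V ≃ₗᵢ[ℝ] V :=
  Unitary.linearIsometryEquiv ⟨NormedSpace.exp (s • (A : V →L[ℝ] V)), exp_smul_mem_unitary A.2 s⟩

theorem expRotation_apply (A : skewAdjoint (V →L[ℝ] V)) (s : ℝ) (x : V) :
    expRotation A s x = NormedSpace.exp (s • (A : V →L[ℝ] V)) x := rfl

@[simp] theorem expRotation_zero (A : skewAdjoint (V →L[ℝ] V)) (x : V) : expRotation A 0 x = x := by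
  simp [expRotation_apply]

theorem expRotation_neg_apply (A : skewAdjoint (V →L[ℝ] V)) (s : ℝ) (x : V) :
    expRotation A (-s) (expRotation A s x) = x := by
  let _ : NormedAlgebra ℚ (V →L[ℝ] V) := .restrictScalars ℚ ℝ _
  have h := NormedSpace.exp_add_of_commute (Commute.refl (s • (A : V →L[ℝ] V))).neg_left
  rw [neg_add_cancel, NormedSpace.exp_zero, ← neg_smul] at h
  exact (DFunLike.congr_fun h x).symm

theorem contDiff_exp_smul (A : V →L[ℝ] V) :
    ContDiff ℝ ∞ (fun s : ℝ ↦ NormedSpace.exp (s • A)) := by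
  have h : ContDiff ℝ ∞ (NormedSpace.exp : (V →L[ℝ] V) → (V →L[ℝ] V)) :=
    contDiff_iff_contDiffAt.2 fun x ↦ (NormedSpace.exp_analytic (𝕂 := ℝ) x).contDiffAt
  exact h.comp (contDiff_id.smul contDiff_const)

theorem hasDerivAt_expRotation (A : skewAdjoint (V →L[ℝ] V)) (s : ℝ) (x : V) :
    HasDerivAt (fun s ↦ expRotation A s x) (expRotation A s ((A : V →L[ℝ] V) x)) s :=
  (hasDerivAt_exp_smul_const (A : V →L[ℝ] V) s).clm_apply (hasDerivAt_const s x) |>.congr_deriv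
    (by simp [expRotation_apply])

/-- The rotation by angle `s / √2` in the plane of the `i`-th and `j`-th coordinates is generated by
`x ↦ (x_i e_j - x_j e_i) / √2`. With this normalization the sum over all ordered pairs of the
squares of the generators is the Laplace operator of the sphere. -/
noncomputable def planeGenerator {m : ℕ} (a : Fin m × Fin m) :
    skewAdjoint (EuclideanSpace ℝ (Fin m) →L[ℝ] EuclideanSpace ℝ (Fin m)) :=
  ⟨(1 / √2 : ℝ) • (InnerProductSpace.rankOne ℝ (EuclideanSpace.single a.2 1)
      (EuclideanSpace.single a.1 1) - InnerProductSpace.rankOne ℝ (EuclideanSpace.single a.1 1)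
      (EuclideanSpace.single a.2 1)), by
    rw [skewAdjoint.mem_iff, star_smul, star_sub, ContinuousLinearMap.star_eq_adjoint,
      ContinuousLinearMap.star_eq_adjoint, InnerProductSpace.adjoint_rankOne,
      InnerProductSpace.adjoint_rankOne, star_trivial, ← neg_sub, smul_neg]⟩

/-- The underlying operator of `planeGenerator`. -/
noncomputable abbrev planeOp {m : ℕ} (a : Fin m × Fin m) :
    EuclideanSpace ℝ (Fin m) →L[ℝ] EuclideanSpace ℝ (Fin m) := planeGenerator a

theorem planeOp_apply {m : ℕ} (a : Fin m × Fin m) (x : EuclideanSpace ℝ (Fin m)) :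
    planeOp a x = (1 / √2 : ℝ) •
      (x a.1 • EuclideanSpace.single a.2 (1 : ℝ) - x a.2 • EuclideanSpace.single a.1 (1 : ℝ)) := by
  simp [planeOp, planeGenerator, EuclideanSpace.inner_single_left]

theorem inner_planeOp {m : ℕ} (a : Fin m × Fin m) (x v : EuclideanSpace ℝ (Fin m)) :
    inner ℝ (planeOp a x) v = 1 / √2 * (x a.1 * v a.2 - x a.2 * v a.1) := by
  rw [planeOp_apply, real_inner_smul_left, inner_sub_left, real_inner_smul_left,
    real_inner_smul_left]
  simp [EuclideanSpace.inner_single_left]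

/-- The velocities of the coordinate rotations at a point of the unit sphere form a tight frame of
its tangent space. -/
theorem sum_inner_planeOp {m : ℕ} (x v w : EuclideanSpace ℝ (Fin m)) :
    ∑ a : Fin m × Fin m, inner ℝ (planeOp a x) v * inner ℝ (planeOp a x) w =
      ‖x‖ ^ 2 * inner ℝ v w - inner ℝ x v * inner ℝ x w := by
  have h2 : (1 / √2 : ℝ) * (1 / √2) = 1 / 2 := by
    rw [div_mul_div_comm, Real.mul_self_sqrt (by norm_num), one_mul]
  have h : ∀ a b : ℝ, (1 / √2 * a) * (1 / √2 * b) = 1 / 2 * (a * b) := fun a b ↦ by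
    rw [← h2]; ring
  simp_rw [inner_planeOp, h]
  rw [← Finset.mul_sum, Fintype.sum_prod_type, ← real_inner_self_eq_norm_sq]
  simp only [PiLp.inner_apply, RCLike.inner_apply, conj_trivial, Finset.sum_mul_sum,
    ← Finset.sum_sub_distrib]
  have hs : ∑ i, ∑ j, (x i * v j - x j * v i) * (x i * w j - x j * w i) =
      ∑ i, ∑ j, (x i * x i * (w j * v j) - v i * x i * (w j * x j)) +
        ∑ i, ∑ j, (x j * x j * (w i * v i) - v j * x j * (w i * x i)) := by
    simp only [← Finset.sum_add_distrib]
    exact Finset.sum_congr rfl fun i _ ↦ Finset.sum_congr rfl fun j _ ↦ by ring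
  rw [hs, Finset.sum_comm (f := fun i j ↦ x j * x j * (w i * v i) - v j * x j * (w i * x i))]
  ring

/-- The sum of the accelerations of the coordinate rotations is normal to the sphere. -/
theorem sum_planeOp_planeOp {k : ℕ} (x : EuclideanSpace ℝ (Fin (k + 1))) :
    ∑ a : Fin (k + 1) × Fin (k + 1), planeOp a (planeOp a x) = -(k : ℝ) • x := by
  refine ext_inner_right ℝ fun v ↦ ?_
  have h : ∀ a : Fin (k + 1) × Fin (k + 1), inner ℝ (planeOp a (planeOp a x)) v =
      1 / 2 * ((if a.1 = a.2 then 2 * (x a.1 * v a.1) else 0) - x a.2 * v a.2 - x a.1 * v a.1) := by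
    intro a
    have h2 : (1 / √2 : ℝ) * (1 / √2) = 1 / 2 := by
      rw [div_mul_div_comm, Real.mul_self_sqrt (by norm_num), one_mul]
    rw [inner_planeOp, planeOp_apply, ← h2]
    obtain ⟨i, j⟩ := a
    by_cases hij : i = j
    · subst hij; simp; ring
    · simp [hij, Ne.symm hij]; ring
  rw [sum_inner, Finset.sum_congr rfl fun a _ ↦ h a, real_inner_smul_left, Fintype.sum_prod_type]
  simp [← Finset.mul_sum, Finset.sum_sub_distrib, PiLp.inner_apply, mul_comm (v _)]
  ring

end Rotations

/-! ### The Laplace operator of a product of spheres -/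

section SphereProduct

variable {k l n : ℕ} {F : Type*} [NormedAddCommGroup F]

theorem contMDiff_coe_unitSphere (n : ℕ) :
    ContMDiff (𝓡 n) 𝓘(ℝ, EuclideanSpace ℝ (Fin (n + 1))) ∞
      ((↑) : Sphere n → EuclideanSpace ℝ (Fin (n + 1))) :=
  haveI := Fact.mk (@finrank_euclideanSpace_fin ℝ _ (n + 1))
  contMDiff_coe_sphere

instance : IsFiniteMeasure (sphereVolume k) :=
  inferInstanceAs (IsFiniteMeasure (volume : Measure (EuclideanSpace ℝ (Fin (k + 1)))).toSphere)

/-- The index set of the one-parameter groups acting on a product of two spheres. -/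
abbrev RotationIndex (k l : ℕ) : Type := (Fin (k + 1) × Fin (k + 1)) ⊕ (Fin (l + 1) × Fin (l + 1))

/-- The one-parameter groups of coordinate rotations of either factor, acting on the product of two
spheres. -/
noncomputable def rotationFlow :
    RotationIndex k l → ℝ → Sphere k × Sphere l → Sphere k × Sphere l
  | .inl a, s, z => ((expRotation (planeGenerator a) s).onSphere z.1, z.2)
  | .inr a, s, z => (z.1, (expRotation (planeGenerator a) s).onSphere z.2)

theorem contMDiff_onSphere_expRotation
    (A : skewAdjoint (EuclideanSpace ℝ (Fin (k + 1)) →L[ℝ] EuclideanSpace ℝ (Fin (k + 1)))) :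
    ContMDiff (𝓘(ℝ, ℝ).prod (𝓡 k)) (𝓡 k) ∞
      (fun z : ℝ × Sphere k ↦ (expRotation A z.1).onSphere z.2) := by
  have h : ContMDiff (𝓘(ℝ, ℝ).prod (𝓡 k)) 𝓘(ℝ, EuclideanSpace ℝ (Fin (k + 1))) ∞
      (fun z : ℝ × Sphere k ↦ expRotation A z.1 z.2) :=
    ((contDiff_exp_smul _).contMDiff.comp contMDiff_fst).clm_apply
      ((contMDiff_coe_unitSphere k).comp contMDiff_snd)
  have := Fact.mk (@finrank_euclideanSpace_fin ℝ _ (k + 1))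
  exact h.codRestrict_sphere fun z ↦ by simp

theorem contMDiff_rotationFlow (a : RotationIndex k l) :
    ContMDiff (𝓘(ℝ, ℝ).prod ((𝓡 k).prod (𝓡 l))) ((𝓡 k).prod (𝓡 l)) ∞
      (fun z : ℝ × (Sphere k × Sphere l) ↦ rotationFlow a z.1 z.2) := by
  cases a with
  | inl a =>
    exact ((contMDiff_onSphere_expRotation (planeGenerator a)).comp
      (contMDiff_fst.prodMk (contMDiff_fst.comp contMDiff_snd))).prodMk
      (contMDiff_snd.comp contMDiff_snd)
  | inr a =>
    exact (contMDiff_fst.comp contMDiff_snd).prodMk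
      ((contMDiff_onSphere_expRotation (planeGenerator a)).comp
      (contMDiff_fst.prodMk (contMDiff_snd.comp contMDiff_snd)))

@[simp] theorem rotationFlow_zero (a : RotationIndex k l) (z : Sphere k × Sphere l) :
    rotationFlow a 0 z = z := by
  cases a <;> simp [rotationFlow, LinearIsometryEquiv.onSphere]

theorem rotationFlow_neg_apply (a : RotationIndex k l) (s : ℝ) (z : Sphere k × Sphere l) :
    rotationFlow a (-s) (rotationFlow a s z) = z := by
  cases a <;> simp [rotationFlow, LinearIsometryEquiv.onSphere, expRotation_neg_apply]

theorem measurePreserving_rotationFlow (a : RotationIndex k l) (s : ℝ) :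
    MeasurePreserving (rotationFlow a s) ((sphereVolume k).prod (sphereVolume l))
      ((sphereVolume k).prod (sphereVolume l)) := by
  cases a with
  | inl a =>
    exact (LinearIsometryEquiv.measurePreserving_onSphere _).prod (MeasurePreserving.id _)
  | inr a =>
    exact (MeasurePreserving.id _).prod (LinearIsometryEquiv.measurePreserving_onSphere _)

theorem contMDiff_rotationFlow_right (a : RotationIndex k l) (z : Sphere k × Sphere l) :
    ContMDiff 𝓘(ℝ, ℝ) ((𝓡 k).prod (𝓡 l)) ∞ (fun s ↦ rotationFlow a s z) :=
  (contMDiff_rotationFlow a).comp (contMDiff_id.prodMk contMDiff_const)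

section Laplacian

variable [NormedSpace ℝ F]

/-- The Laplace operator of a product of two round spheres, written as the sum of the squares of
the infinitesimal coordinate rotations of the factors. -/
noncomputable def rotationLaplacian (u : Sphere k × Sphere l → F) (z : Sphere k × Sphere l) : F :=
  ∑ a, deriv (deriv fun s ↦ u (rotationFlow a s z)) 0

theorem contMDiff_deriv_deriv_rotationFlow (a : RotationIndex k l) {U : ℝ → Sphere k × Sphere l → F}
    (hU : ContMDiff (𝓘(ℝ, ℝ).prod ((𝓡 k).prod (𝓡 l))) 𝓘(ℝ, F) ∞
      (fun p : ℝ × (Sphere k × Sphere l) ↦ U p.1 p.2)) :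
    ContMDiff (𝓘(ℝ, ℝ).prod ((𝓡 k).prod (𝓡 l))) 𝓘(ℝ, F) ∞
      (fun p : ℝ × (Sphere k × Sphere l) ↦
        deriv (deriv fun s ↦ U p.1 (rotationFlow a s p.2)) 0) := by
  have h1 : ContMDiff (𝓘(ℝ, ℝ).prod (𝓘(ℝ, ℝ).prod ((𝓡 k).prod (𝓡 l)))) 𝓘(ℝ, F) ∞
      (fun q : ℝ × (ℝ × (Sphere k × Sphere l)) ↦
        (fun (s : ℝ) (p : ℝ × (Sphere k × Sphere l)) ↦ U p.1 (rotationFlow a s p.2)) q.1 q.2) :=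
    hU.comp ((contMDiff_fst.comp contMDiff_snd).prodMk ((contMDiff_rotationFlow a).comp
      (contMDiff_fst.prodMk (contMDiff_snd.comp contMDiff_snd))))
  exact (ContMDiff.partialDeriv
    (G := fun s (p : ℝ × (Sphere k × Sphere l)) ↦ deriv (fun s ↦ U p.1 (rotationFlow a s p.2)) s)
    (ContMDiff.partialDeriv
      (G := fun s (p : ℝ × (Sphere k × Sphere l)) ↦ U p.1 (rotationFlow a s p.2)) h1)).comp
    (contMDiff_const.prodMk contMDiff_id)

theorem contMDiff_rotationLaplacian {U : ℝ → Sphere k × Sphere l → F}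
    (hU : ContMDiff (𝓘(ℝ, ℝ).prod ((𝓡 k).prod (𝓡 l))) 𝓘(ℝ, F) ∞
      (fun p : ℝ × (Sphere k × Sphere l) ↦ U p.1 p.2)) :
    ContMDiff (𝓘(ℝ, ℝ).prod ((𝓡 k).prod (𝓡 l))) 𝓘(ℝ, F) ∞
      (fun p : ℝ × (Sphere k × Sphere l) ↦ rotationLaplacian (U p.1) p.2) :=
  contMDiff_finsetSum fun a _ ↦ contMDiff_deriv_deriv_rotationFlow a hU

end Laplacian

section SelfAdjoint

variable [InnerProductSpace ℝ F]

theorem deriv_deriv_integral {G : ℝ → Sphere k × Sphere l → ℝ}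
    (hG : ContMDiff (𝓘(ℝ, ℝ).prod ((𝓡 k).prod (𝓡 l))) 𝓘(ℝ, ℝ) ∞
      (fun p : ℝ × (Sphere k × Sphere l) ↦ G p.1 p.2)) :
    deriv (deriv fun s ↦ ∫ z, G s z ∂(sphereVolume k).prod (sphereVolume l)) 0 =
      ∫ z, deriv (deriv fun s ↦ G s z) 0 ∂(sphereVolume k).prod (sphereVolume l) := by
  have h1 : (deriv fun s ↦ ∫ z, G s z ∂(sphereVolume k).prod (sphereVolume l)) =
      fun s ↦ ∫ z, deriv (fun s ↦ G s z) s ∂(sphereVolume k).prod (sphereVolume l) :=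
    funext fun s ↦ (hG.hasDerivAt_integral s).deriv
  rw [h1]
  exact (ContMDiff.hasDerivAt_integral (G := fun s z ↦ deriv (fun s ↦ G s z) s)
    hG.partialDeriv 0).deriv

theorem integrable_of_continuous {u : Sphere k × Sphere l → F} (hu : Continuous u) :
    Integrable u ((sphereVolume k).prod (sphereVolume l)) :=
  hu.integrable_of_hasCompactSupport (HasCompactSupport.of_compactSpace _)

theorem integral_inner_rotationFlow (a : RotationIndex k l) (s : ℝ)
    {u v : Sphere k × Sphere l → F} (hu : Continuous u) (hv : Continuous v) :
    ∫ z, inner ℝ (u z) (v (rotationFlow a s z)) ∂(sphereVolume k).prod (sphereVolume l) =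
      ∫ z, inner ℝ (u (rotationFlow a (-s) z)) (v z) ∂(sphereVolume k).prod (sphereVolume l) := by
  have hc : ∀ s, Continuous (rotationFlow (k := k) (l := l) a s) := fun s ↦
    (contMDiff_rotationFlow a).continuous.comp (Continuous.prodMk continuous_const continuous_id)
  have h := measurePreserving_rotationFlow (k := k) (l := l) a s
  conv_rhs => rw [← h.map_eq]
  rw [integral_map h.measurable.aemeasurable
    ((hu.comp (hc _)).inner hv).aestronglyMeasurable]
  simp only [rotationFlow_neg_apply]

/-- The Laplace operator is symmetric, because the rotations preserve the measure. -/
theorem integral_inner_rotationLaplacian {u v : Sphere k × Sphere l → F}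
    (hu : ContMDiff ((𝓡 k).prod (𝓡 l)) 𝓘(ℝ, F) ∞ u)
    (hv : ContMDiff ((𝓡 k).prod (𝓡 l)) 𝓘(ℝ, F) ∞ v) :
    ∫ z, inner ℝ (u z) (rotationLaplacian v z) ∂(sphereVolume k).prod (sphereVolume l) =
      ∫ z, inner ℝ (rotationLaplacian u z) (v z) ∂(sphereVolume k).prod (sphereVolume l) := by
  have hs : ∀ (w : Sphere k × Sphere l → F), ContMDiff ((𝓡 k).prod (𝓡 l)) 𝓘(ℝ, F) ∞ w → ∀ a,
      ContMDiff (𝓘(ℝ, ℝ).prod ((𝓡 k).prod (𝓡 l))) 𝓘(ℝ, F) ∞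
      (fun p : ℝ × (Sphere k × Sphere l) ↦ w (rotationFlow a p.1 p.2)) :=
    fun w hw a ↦ hw.comp (contMDiff_rotationFlow a)
  have hd : ∀ (w : Sphere k × Sphere l → F), ContMDiff ((𝓡 k).prod (𝓡 l)) 𝓘(ℝ, F) ∞ w → ∀ a,
      Continuous fun z ↦ deriv (deriv fun s ↦ w (rotationFlow a s z)) 0 := fun w hw a ↦
    (contMDiff_deriv_deriv_rotationFlow a (U := fun _ ↦ w) (hw.comp contMDiff_snd)).continuous.comp
      (Continuous.prodMk (continuous_const (y := (0 : ℝ))) continuous_id)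
  have inner_smooth : ∀ {f g : ℝ × (Sphere k × Sphere l) → F},
      ContMDiff (𝓘(ℝ, ℝ).prod ((𝓡 k).prod (𝓡 l))) 𝓘(ℝ, F) ∞ f →
      ContMDiff (𝓘(ℝ, ℝ).prod ((𝓡 k).prod (𝓡 l))) 𝓘(ℝ, F) ∞ g →
      ContMDiff (𝓘(ℝ, ℝ).prod ((𝓡 k).prod (𝓡 l))) 𝓘(ℝ, ℝ) ∞ (fun p ↦ inner ℝ (f p) (g p)) := by
    exact fun hf hg ↦ contDiff_inner.contMDiff.comp (hf.prodMk_space hg)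
  simp only [rotationLaplacian, inner_sum, sum_inner]
  rw [integral_finsetSum _ fun a _ ↦ integrable_of_continuous (hu.continuous.inner (hd v hv a)),
    integral_finsetSum _ fun a _ ↦ integrable_of_continuous ((hd u hu a).inner hv.continuous)]
  refine Finset.sum_congr rfl fun a _ ↦ ?_
  have e : ∀ (w : Sphere k × Sphere l → F), ContMDiff ((𝓡 k).prod (𝓡 l)) 𝓘(ℝ, F) ∞ w →
      ∀ (c : F) z, inner ℝ c (deriv (deriv fun s ↦ w (rotationFlow a s z)) 0) =
        deriv (deriv fun s ↦ inner ℝ c (w (rotationFlow a s z))) 0 := by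
    intro w hw c z
    have h1 : (deriv fun s ↦ inner ℝ c (w (rotationFlow a s z))) =
        fun s ↦ inner ℝ c (deriv (fun s ↦ w (rotationFlow a s z)) s) := funext fun s ↦
      (((innerSL ℝ c).hasFDerivAt).comp_hasDerivAt s
        (ContMDiff.hasDerivAt_partial (G := fun s z ↦ w (rotationFlow a s z))
          (hs w hw a) s z)).deriv
    rw [h1]
    exact (((innerSL ℝ c).hasFDerivAt).comp_hasDerivAt 0
      (ContMDiff.hasDerivAt_partial (G := fun s z ↦ deriv (fun s ↦ w (rotationFlow a s z)) s)
        (ContMDiff.partialDeriv (G := fun s z ↦ w (rotationFlow a s z))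
          (hs w hw a)) 0 z)).deriv.symm
  have e2 : ∀ z, inner ℝ (deriv (deriv fun s ↦ u (rotationFlow a s z)) 0) (v z) =
      deriv (deriv fun s ↦ inner ℝ (u (rotationFlow a (-s) z)) (v z)) 0 := by
    intro z
    rw [real_inner_comm, e u hu]
    simp_rw [real_inner_comm (v z)]
    have h1 : (deriv fun s ↦ inner ℝ (v z) (u (rotationFlow a (-s) z))) =
        fun s ↦ -deriv (fun s ↦ inner ℝ (v z) (u (rotationFlow a s z))) (-s) :=
      funext fun s ↦ deriv_comp_neg (fun s ↦ inner ℝ (v z) (u (rotationFlow a s z))) s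
    rw [h1, deriv.fun_neg, deriv_comp_neg, neg_neg, neg_zero]
  simp_rw [e v hv, e2]
  rw [← deriv_deriv_integral (inner_smooth (hu.comp contMDiff_snd) (hs v hv a)),
    ← deriv_deriv_integral]
  · congr 2
    exact funext fun s ↦ integral_inner_rotationFlow a s hu.continuous hv.continuous
  · exact inner_smooth ((hs u hu a).comp ((contDiff_neg.contMDiff.comp contMDiff_fst).prodMk
      contMDiff_snd)) (hv.comp contMDiff_snd)

end SelfAdjoint

end SphereProduct

/-! ### The tension field of a map from a product of spheres into a sphere -/

section SphereProduct

variable {k l n : ℕ}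

theorem isIsometricImmersion_sphere (n : ℕ) :
    IsIsometricImmersion (sphereMetric n) ((↑) : Sphere n → EuclideanSpace ℝ (Fin (n + 1))) where
  contMDiff := contMDiff_coe_unitSphere n
  inner_eq _ _ _ := rfl

/-- The inclusion of a product of two spheres into the Euclidean product of the ambient spaces. -/
noncomputable def prodInclusion (z : Sphere k × Sphere l) :
    WithLp 2 (EuclideanSpace ℝ (Fin (k + 1)) × EuclideanSpace ℝ (Fin (l + 1))) :=
  WithLp.toLp 2 ((z.1 : EuclideanSpace ℝ (Fin (k + 1))), (z.2 : EuclideanSpace ℝ (Fin (l + 1))))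

theorem contMDiff_prodInclusion :
    ContMDiff ((𝓡 k).prod (𝓡 l)) 𝓘(ℝ, WithLp 2 (EuclideanSpace ℝ (Fin (k + 1)) ×
      EuclideanSpace ℝ (Fin (l + 1)))) ∞ (prodInclusion (k := k) (l := l)) :=
  (WithLp.prodContinuousLinearEquiv 2 ℝ _ _).symm.contDiff.contMDiff.comp
    (((contMDiff_coe_unitSphere k).comp contMDiff_fst).prodMk_space
      ((contMDiff_coe_unitSphere l).comp contMDiff_snd))

theorem mvfderiv_prodInclusion (z : Sphere k × Sphere l)
    (v : TangentSpace ((𝓡 k).prod (𝓡 l)) z) :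
    mvfderiv ((𝓡 k).prod (𝓡 l)) prodInclusion z v = WithLp.toLp 2
      (mvfderiv (𝓡 k) ((↑) : Sphere k → EuclideanSpace ℝ (Fin (k + 1))) z.1 v.1,
        mvfderiv (𝓡 l) ((↑) : Sphere l → EuclideanSpace ℝ (Fin (l + 1))) z.2 v.2) := by
  have hι := (contMDiff_prodInclusion (k := k) (l := l)).mdifferentiableAt (by simp) (x := z)
  have h1 : HasMFDerivAt ((𝓡 k).prod (𝓡 l)) 𝓘(ℝ, EuclideanSpace ℝ (Fin (k + 1)))
      (fun z : Sphere k × Sphere l ↦ (z.1 : EuclideanSpace ℝ (Fin (k + 1)))) z _ :=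
    HasMFDerivAt.comp z (((contMDiff_coe_unitSphere k).mdifferentiableAt
      (by simp)).hasMFDerivAt (x := z.1)) (hasMFDerivAt_fst z)
  have h2 : HasMFDerivAt ((𝓡 k).prod (𝓡 l)) 𝓘(ℝ, EuclideanSpace ℝ (Fin (l + 1)))
      (fun z : Sphere k × Sphere l ↦ (z.2 : EuclideanSpace ℝ (Fin (l + 1)))) z _ :=
    HasMFDerivAt.comp z (((contMDiff_coe_unitSphere l).mdifferentiableAt
      (by simp)).hasMFDerivAt (x := z.2)) (hasMFDerivAt_snd z)
  let L := (WithLp.prodContinuousLinearEquiv 2 ℝ (EuclideanSpace ℝ (Fin (k + 1)))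
    (EuclideanSpace ℝ (Fin (l + 1)))).toContinuousLinearMap
  have h1' := HasMFDerivAt.comp z (((ContinuousLinearMap.fst ℝ _ _).comp L).hasFDerivAt
    (x := prodInclusion z)).hasMFDerivAt hι.hasMFDerivAt
  have h2' := HasMFDerivAt.comp z (((ContinuousLinearMap.snd ℝ _ _).comp L).hasFDerivAt
    (x := prodInclusion z)).hasMFDerivAt hι.hasMFDerivAt
  have e1 := DFunLike.congr_fun (hasMFDerivAt_unique h1' h1) v
  have e2 := DFunLike.congr_fun (hasMFDerivAt_unique h2' h2) v
  exact congrArg (WithLp.toLp 2) (Prod.ext e1 e2)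

theorem isIsometricImmersion_prod (k l : ℕ) :
    IsIsometricImmersion (prodMetric (sphereMetric k) (sphereMetric l))
      (prodInclusion (k := k) (l := l)) where
  contMDiff := contMDiff_prodInclusion
  inner_eq z v w := by
    rw [mvfderiv_prodInclusion, mvfderiv_prodInclusion, WithLp.prod_inner_apply]
    change (sphereMetric k).inner z.1 (mfderiv ((𝓡 k).prod (𝓡 l)) (𝓡 k) Prod.fst z v)
        (mfderiv ((𝓡 k).prod (𝓡 l)) (𝓡 k) Prod.fst z w) +
      (sphereMetric l).inner z.2 (mfderiv ((𝓡 k).prod (𝓡 l)) (𝓡 l) Prod.snd z v)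
        (mfderiv ((𝓡 k).prod (𝓡 l)) (𝓡 l) Prod.snd z w) = _
    rw [mfderiv_fst, mfderiv_snd]
    rfl

theorem range_mvfderiv_sphere (y : Sphere n) :
    (mvfderiv (𝓡 n) ((↑) : Sphere n → EuclideanSpace ℝ (Fin (n + 1))) y).range =
      (Submodule.span ℝ {(y : EuclideanSpace ℝ (Fin (n + 1)))})ᗮ :=
  have := Fact.mk (@finrank_euclideanSpace_fin ℝ _ (n + 1))
  range_mvfderiv_subtypeVal y

theorem inner_mvfderiv_sphere (y : Sphere n) (v : TangentSpace (𝓡 n) y) :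
    inner ℝ (y : EuclideanSpace ℝ (Fin (n + 1)))
      (mvfderiv (𝓡 n) ((↑) : Sphere n → EuclideanSpace ℝ (Fin (n + 1))) y v) = 0 := by
  have h : mvfderiv (𝓡 n) ((↑) : Sphere n → EuclideanSpace ℝ (Fin (n + 1))) y v ∈
      (Submodule.span ℝ {(y : EuclideanSpace ℝ (Fin (n + 1)))})ᗮ := by
    rw [← range_mvfderiv_sphere]; exact ⟨v, rfl⟩
  exact Submodule.mem_orthogonal_singleton_iff_inner_right.1 h

theorem exists_mvfderiv_sphere_eq (y : Sphere n) {w : EuclideanSpace ℝ (Fin (n + 1))}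
    (hw : inner ℝ (y : EuclideanSpace ℝ (Fin (n + 1))) w = 0) :
    ∃ v : TangentSpace (𝓡 n) y,
      mvfderiv (𝓡 n) ((↑) : Sphere n → EuclideanSpace ℝ (Fin (n + 1))) y v = w := by
  have h := Submodule.mem_orthogonal_singleton_iff_inner_right.2 hw
  rw [← range_mvfderiv_sphere] at h
  exact h

theorem deriv_prodInclusion_rotationFlow (a : RotationIndex k l) (z : Sphere k × Sphere l) :
    deriv (prodInclusion ∘ fun s ↦ rotationFlow a s z) = fun s ↦ match a with
      | .inl a => WithLp.toLp 2 (expRotation (planeGenerator a) s (planeOp a z.1), 0)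
      | .inr a => WithLp.toLp 2 (0, expRotation (planeGenerator a) s (planeOp a z.2)) := by
  funext s
  let L := (WithLp.prodContinuousLinearEquiv 2 ℝ (EuclideanSpace ℝ (Fin (k + 1)))
    (EuclideanSpace ℝ (Fin (l + 1)))).symm
  cases a with
  | inl a =>
    exact (L.hasFDerivAt.comp_hasDerivAt s
      ((hasDerivAt_expRotation (planeGenerator a) s (z.1 : EuclideanSpace ℝ (Fin (k + 1)))).prodMk
        (hasDerivAt_const s (z.2 : EuclideanSpace ℝ (Fin (l + 1)))))).deriv
  | inr a =>
    exact (L.hasFDerivAt.comp_hasDerivAt s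
      ((hasDerivAt_const s (z.1 : EuclideanSpace ℝ (Fin (k + 1)))).prodMk
        (hasDerivAt_expRotation (planeGenerator a) s (z.2 : EuclideanSpace ℝ (Fin (l + 1)))))).deriv

theorem deriv_deriv_prodInclusion_rotationFlow (a : RotationIndex k l) (z : Sphere k × Sphere l) :
    deriv (deriv (prodInclusion ∘ fun s ↦ rotationFlow a s z)) 0 = match a with
      | .inl a => WithLp.toLp 2 (planeOp a (planeOp a z.1), 0)
      | .inr a => WithLp.toLp 2 (0, planeOp a (planeOp a z.2)) := by
  rw [deriv_prodInclusion_rotationFlow]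
  let L := (WithLp.prodContinuousLinearEquiv 2 ℝ (EuclideanSpace ℝ (Fin (k + 1)))
    (EuclideanSpace ℝ (Fin (l + 1)))).symm
  cases a with
  | inl a =>
    refine (L.hasFDerivAt.comp_hasDerivAt 0
      ((hasDerivAt_expRotation (planeGenerator a) 0 (planeOp a z.1)).prodMk
        (hasDerivAt_const 0 _))).deriv.trans ?_
    rw [expRotation_zero]
    rfl
  | inr a =>
    refine (L.hasFDerivAt.comp_hasDerivAt 0
      ((hasDerivAt_const 0 _).prodMk
        (hasDerivAt_expRotation (planeGenerator a) 0 (planeOp a z.2)))).deriv.trans ?_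
    rw [expRotation_zero]
    rfl

/-- The squared norm of the tension field of a map into a sphere, in terms of the Laplacian of the
map into the ambient space. -/
theorem inner_tensionField_self {Φ : Sphere k × Sphere l → Sphere n}
    (hΦ : ContMDiff ((𝓡 k).prod (𝓡 l)) (𝓡 n) ∞ Φ) (z : Sphere k × Sphere l) :
    (sphereMetric n).inner (Φ z)
        (tensionField (prodMetric (sphereMetric k) (sphereMetric l)) (sphereMetric n) Φ z)
        (tensionField (prodMetric (sphereMetric k) (sphereMetric l)) (sphereMetric n) Φ z) =
      ‖rotationLaplacian (fun z ↦ (Φ z : EuclideanSpace ℝ (Fin (n + 1)))) z‖ ^ 2 -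
      inner ℝ (rotationLaplacian (fun z ↦ (Φ z : EuclideanSpace ℝ (Fin (n + 1)))) z)
        (Φ z : EuclideanSpace ℝ (Fin (n + 1))) ^ 2 := by
  set W := rotationLaplacian (fun z ↦ (Φ z : EuclideanSpace ℝ (Fin (n + 1)))) z with hW
  set τ := tensionField (prodMetric (sphereMetric k) (sphereMetric l)) (sphereMetric n) Φ z
  set y : EuclideanSpace ℝ (Fin (n + 1)) := (Φ z : EuclideanSpace ℝ (Fin (n + 1))) with hy
  have hy1 : inner ℝ y y = 1 := by rw [real_inner_self_eq_norm_sq, hy]; simp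
  have key : ∀ w, (sphereMetric n).inner (Φ z) τ w = inner ℝ W
      (mvfderiv (𝓡 n) ((↑) : Sphere n → EuclideanSpace ℝ (Fin (n + 1))) (Φ z) w) := by
    intro w
    refine inner_tensionField (isIsometricImmersion_prod k l) (isIsometricImmersion_sphere n) hΦ
      (γ := fun a s ↦ rotationFlow a s z) (fun a ↦ contMDiff_rotationFlow_right a z)
      (fun a ↦ rotationFlow_zero a z) ?_ ?_ w
    · intro v w
      rw [(isIsometricImmersion_prod k l).inner_eq]
      have o1 := inner_mvfderiv_sphere z.1 v.1
      have o2 := inner_mvfderiv_sphere z.2 v.2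
      simp only [deriv_prodInclusion_rotationFlow, mvfderiv_prodInclusion, WithLp.prod_inner_apply,
        Fintype.sum_sum_type, expRotation_zero, inner_zero_left, add_zero, zero_add,
        sum_inner_planeOp, o1, o2, zero_mul, sub_zero, norm_eq_of_mem_sphere, one_pow, one_mul]
    · intro v
      have o1 := inner_mvfderiv_sphere z.1 v.1
      have o2 := inner_mvfderiv_sphere z.2 v.2
      rw [sum_inner, Fintype.sum_sum_type]
      simp only [deriv_deriv_prodInclusion_rotationFlow, mvfderiv_prodInclusion,
        WithLp.prod_inner_apply, inner_zero_left, add_zero, zero_add]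
      rw [← sum_inner, ← sum_inner, sum_planeOp_planeOp, sum_planeOp_planeOp, real_inner_smul_left,
        real_inner_smul_left, o1, o2, mul_zero, mul_zero, add_zero]
  have hin := (isIsometricImmersion_sphere n).inner_eq (Φ z)
  -- test against the tangential part of `W`
  obtain ⟨v, hv⟩ := exists_mvfderiv_sphere_eq (Φ z) (w := W - inner ℝ W y • y) (by
    rw [← hy, inner_sub_right, real_inner_smul_right, hy1, real_inner_comm]; ring)
  have h1 := key v
  have h2 := (real_inner_comm _ _).trans (inner_mvfderiv_sphere (Φ z) τ)
  rw [← hy] at h2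
  rw [hin, hv, inner_sub_right, inner_sub_right, real_inner_smul_right, real_inner_smul_right,
    h2, mul_zero, sub_zero, real_inner_self_eq_norm_sq] at h1
  rw [key, real_inner_comm, h1]
  ring

end SphereProduct

/-! ### The first variation of the bienergy -/

section Biharmonic

variable {k l n : ℕ}

/-- A map `φ` into a sphere with `⟪Δφ, φ⟫ = -c` constant is biharmonic as soon as
`Δ(Δφ + c φ) + c Δφ = 0`, which is the Euler–Lagrange equation of the bienergy in this case. -/
theorem isBiharmonic_of_rotationLaplacian {φ : Sphere k × Sphere l → Sphere n}
    (hφ : ContMDiff ((𝓡 k).prod (𝓡 l)) (𝓡 n) ∞ φ) (c : ℝ)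
    {W : Sphere k × Sphere l → EuclideanSpace ℝ (Fin (n + 1))}
    (hW : W = rotationLaplacian fun z ↦ (φ z : EuclideanSpace ℝ (Fin (n + 1))))
    (hc : ∀ z, inner ℝ (W z) (φ z : EuclideanSpace ℝ (Fin (n + 1))) = -c)
    (hEL : ∀ z, rotationLaplacian
      (fun z ↦ W z + c • (φ z : EuclideanSpace ℝ (Fin (n + 1)))) z + c • W z = 0) :
    IsBiharmonic (prodMetric (sphereMetric k) (sphereMetric l))
      ((sphereVolume k).prod (sphereVolume l)) (sphereMetric n) φ := by
  refine ⟨hφ, fun Ω hΩ Φ hΦ hΦ0 hΦΩ ↦ ?_⟩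
  set u : ℝ → Sphere k × Sphere l → EuclideanSpace ℝ (Fin (n + 1)) := fun t z ↦ Φ t z with hu
  set L : ℝ → Sphere k × Sphere l → EuclideanSpace ℝ (Fin (n + 1)) := fun t ↦
    rotationLaplacian (u t) with hL
  have hus : ContMDiff (𝓘(ℝ, ℝ).prod ((𝓡 k).prod (𝓡 l)))
      𝓘(ℝ, EuclideanSpace ℝ (Fin (n + 1))) ∞
      (fun p : ℝ × (Sphere k × Sphere l) ↦ u p.1 p.2) := (contMDiff_coe_unitSphere n).comp hΦ
  have hLs : ContMDiff (𝓘(ℝ, ℝ).prod ((𝓡 k).prod (𝓡 l)))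
      𝓘(ℝ, EuclideanSpace ℝ (Fin (n + 1))) ∞
      (fun p : ℝ × (Sphere k × Sphere l) ↦ L p.1 p.2) := contMDiff_rotationLaplacian hus
  have at_time : ∀ {E : Type} [NormedAddCommGroup E] [NormedSpace ℝ E]
      {U : ℝ → Sphere k × Sphere l → E}, ContMDiff (𝓘(ℝ, ℝ).prod ((𝓡 k).prod (𝓡 l))) 𝓘(ℝ, E) ∞
      (fun p : ℝ × (Sphere k × Sphere l) ↦ U p.1 p.2) →
      ∀ t, ContMDiff ((𝓡 k).prod (𝓡 l)) 𝓘(ℝ, E) ∞ (U t) :=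
    fun hU t ↦ hU.comp (contMDiff_const.prodMk contMDiff_id)
  have hu0 : ∀ z, u 0 z = φ z := fun z ↦ by simp [hu, hΦ0]
  have hL0 : ∀ z, L 0 z = W z := fun z ↦ by rw [hW]; simp [hL, hu, hΦ0]
  have hφs : ContMDiff ((𝓡 k).prod (𝓡 l)) 𝓘(ℝ, EuclideanSpace ℝ (Fin (n + 1))) ∞
      (fun z ↦ (φ z : EuclideanSpace ℝ (Fin (n + 1)))) := (contMDiff_coe_unitSphere n).comp hφ
  have hWs : ContMDiff ((𝓡 k).prod (𝓡 l)) 𝓘(ℝ, EuclideanSpace ℝ (Fin (n + 1))) ∞ W := by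
    have := at_time hLs 0
    rwa [show L 0 = W from funext hL0] at this
  have inner_smooth : ∀ {f g : ℝ × (Sphere k × Sphere l) → EuclideanSpace ℝ (Fin (n + 1))},
      ContMDiff (𝓘(ℝ, ℝ).prod ((𝓡 k).prod (𝓡 l))) 𝓘(ℝ, EuclideanSpace ℝ (Fin (n + 1))) ∞ f →
      ContMDiff (𝓘(ℝ, ℝ).prod ((𝓡 k).prod (𝓡 l))) 𝓘(ℝ, EuclideanSpace ℝ (Fin (n + 1))) ∞ g →
      ContMDiff (𝓘(ℝ, ℝ).prod ((𝓡 k).prod (𝓡 l))) 𝓘(ℝ, ℝ) ∞ (fun p ↦ inner ℝ (f p) (g p)) :=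
    fun hf hg ↦ contDiff_inner.contMDiff.comp (hf.prodMk_space hg)
  -- the energy density and its linearization
  set e : ℝ → Sphere k × Sphere l → ℝ := fun t z ↦
    inner ℝ (L t z) (L t z) - inner ℝ (L t z) (u t z) ^ 2 with he
  set A : Sphere k × Sphere l → EuclideanSpace ℝ (Fin (n + 1)) := fun z ↦
    W z + c • (φ z : EuclideanSpace ℝ (Fin (n + 1))) with hA
  have hAs : ContMDiff ((𝓡 k).prod (𝓡 l)) 𝓘(ℝ, EuclideanSpace ℝ (Fin (n + 1))) ∞ A :=
    hWs.add ((contDiff_const_smul c).contMDiff.comp hφs)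
  set G : ℝ → Sphere k × Sphere l → ℝ := fun t z ↦
    inner ℝ (A z) (L t z) + c * inner ℝ (W z) (u t z) with hG
  have hes : ContMDiff (𝓘(ℝ, ℝ).prod ((𝓡 k).prod (𝓡 l))) 𝓘(ℝ, ℝ) ∞
      (fun p : ℝ × (Sphere k × Sphere l) ↦ e p.1 p.2) :=
    (inner_smooth hLs hLs).sub ((inner_smooth hLs hus).pow 2)
  have hGs : ContMDiff (𝓘(ℝ, ℝ).prod ((𝓡 k).prod (𝓡 l))) 𝓘(ℝ, ℝ) ∞
      (fun p : ℝ × (Sphere k × Sphere l) ↦ G p.1 p.2) :=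
    (inner_smooth (hAs.comp contMDiff_snd) hLs).add
      (contMDiff_const.mul (inner_smooth (hWs.comp contMDiff_snd) hus))
  have hbi : ∀ t, bienergy (prodMetric (sphereMetric k) (sphereMetric l))
      ((sphereVolume k).prod (sphereVolume l)) (sphereMetric n) (Φ t) Ω =
      1 / 2 * ∫ z in Ω, e t z ∂(sphereVolume k).prod (sphereVolume l) := by
    intro t
    have hΦt : ContMDiff ((𝓡 k).prod (𝓡 l)) (𝓡 n) ∞ (Φ t) :=
      hΦ.comp (contMDiff_const.prodMk contMDiff_id)
    simp only [bienergy, inner_tensionField_self hΦt, he, real_inner_self_eq_norm_sq, hL, hu]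
  -- the first variation is the derivative of `∫ G`, which vanishes by the Euler–Lagrange equation
  have hde : ∀ z, deriv (fun t ↦ e t z) 0 = 2 * deriv (fun t ↦ G t z) 0 := by
    intro z
    have d1 := ContMDiff.hasDerivAt_partial hLs 0 z
    have d2 := ContMDiff.hasDerivAt_partial hus 0 z
    have h1 := ((d1.inner ℝ d1).sub ((d1.inner ℝ d2).pow 2)).deriv
    have h2 := (((hasDerivAt_const 0 (A z)).inner ℝ d1).add
      (((hasDerivAt_const 0 (W z)).inner ℝ d2).const_mul c)).deriv
    refine h1.trans ((Eq.trans ?_ (congrArg (2 * ·) h2.symm)))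
    simp only [hL0, hu0, hc, hA, inner_add_left, real_inner_smul_left, inner_zero_left]
    rw [real_inner_comm (W z) (deriv _ 0), real_inner_comm _ (φ z : EuclideanSpace ℝ (Fin (n + 1)))]
    push_cast
    ring
  have hint : ∀ t, ∫ z, G t z ∂(sphereVolume k).prod (sphereVolume l) = 0 := by
    intro t
    have hut := at_time hus t
    have hLt := at_time hLs t
    have hΔA : ContMDiff ((𝓡 k).prod (𝓡 l)) 𝓘(ℝ, EuclideanSpace ℝ (Fin (n + 1))) ∞
        (rotationLaplacian A) :=
      at_time (U := fun _ ↦ rotationLaplacian A)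
        (contMDiff_rotationLaplacian (U := fun _ ↦ A) (hAs.comp contMDiff_snd)) 0
    have i1 := integrable_of_continuous (F := ℝ) (hAs.continuous.inner (𝕜 := ℝ) hLt.continuous)
    have i2 := integrable_of_continuous (F := ℝ) (hΔA.continuous.inner (𝕜 := ℝ) hut.continuous)
    have i3 := (integrable_of_continuous (F := ℝ)
      (hWs.continuous.inner (𝕜 := ℝ) hut.continuous)).const_mul c
    simp only [hG]
    rw [integral_add i1 i3]
    simp only [hL]
    rw [integral_inner_rotationLaplacian hAs hut, ← integral_add i2 i3]
    refine (integral_congr_ae (.of_forall fun z ↦ ?_)).trans (integral_zero _ _)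
    rw [← real_inner_smul_left, ← inner_add_left, hEL, inner_zero_left]
  -- outside `Ω` the variation is constant near each point, hence so is the density; thus the
  -- integral of its derivative over `Ω` equals that over the whole product
  have hout : ∀ z ∉ Ω, deriv (fun t ↦ e t z) 0 = 0 := by
    intro z hz
    have hΩo : ∀ z ∉ Ω, ∀ t, u t z = u 0 z := fun z hz t ↦ by
      simp only [hu, hΦΩ t z hz, hΦ0]
    have hconst : ∀ t, e t z = e 0 z := by
      intro t
      have hLt : L t z = L 0 z := by
        simp only [hL, rotationLaplacian]
        refine Finset.sum_congr rfl fun a _ ↦ ?_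
        have hev : (fun s ↦ u t (rotationFlow a s z)) =ᶠ[𝓝 0] fun s ↦ u 0 (rotationFlow a s z) := by
          have hcont := (contMDiff_rotationFlow_right a z).continuous.continuousAt (x := (0 : ℝ))
          have hmem : Ωᶜ ∈ 𝓝 (rotationFlow a 0 z) := by
            rw [rotationFlow_zero]; exact hΩ.isClosed.isOpen_compl.mem_nhds hz
          filter_upwards [hcont hmem] with s hs
          exact hΩo _ hs t
        exact hev.deriv.deriv_eq
      simp only [he, hLt, hΩo z hz t]
    rw [show (fun t ↦ e t z) = fun _ ↦ e 0 z from funext hconst, deriv_const]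
  have hG0 : ∫ z, deriv (fun t ↦ G t z) 0 ∂(sphereVolume k).prod (sphereVolume l) = 0 := by
    have h := (hGs.hasDerivAt_integral (μ := (sphereVolume k).prod (sphereVolume l)) 0).deriv
    rw [← h, show (fun t ↦ ∫ z, G t z ∂(sphereVolume k).prod (sphereVolume l)) = fun _ ↦ 0 from
      funext hint, deriv_const]
  have hmain := (hes.hasDerivAt_integral
    (μ := ((sphereVolume k).prod (sphereVolume l)).restrict Ω) 0).const_mul (1 / 2 : ℝ)
  rw [setIntegral_eq_integral_of_forall_compl_eq_zero hout] at hmain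
  simp_rw [hde] at hmain
  rw [integral_const_mul, hG0, mul_zero, mul_zero] at hmain
  exact hmain.congr_of_eventuallyEq (.of_forall hbi)

end Biharmonic

/-! ### Bilinear maps on a product of spheres -/

section LiftedMap

variable {k l n : ℕ}

/-- A bilinear map restricts to an eigenfunction: its restriction to each factor is linear, and
linear functions on the unit sphere of dimension `k` have eigenvalue `-k`. -/
theorem rotationLaplacian_bilinear_add_const {F : Type*} [NormedAddCommGroup F] [NormedSpace ℝ F]
    (B : EuclideanSpace ℝ (Fin (k + 1)) →L[ℝ] EuclideanSpace ℝ (Fin (l + 1)) →L[ℝ] F) (e : F)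
    (z : Sphere k × Sphere l) :
    rotationLaplacian (fun z : Sphere k × Sphere l ↦ B z.1 z.2 + e) z =
      -((k : ℝ) + l) • B z.1 z.2 := by
  have h1 : ∀ a x, deriv (deriv fun s ↦ B (expRotation (planeGenerator a) s x) z.2 + e) 0 =
      B (planeOp a (planeOp a x)) z.2 := by
    intro a x
    have d : ∀ (x : EuclideanSpace ℝ (Fin (k + 1))) s,
        HasDerivAt (fun s ↦ B (expRotation (planeGenerator a) s x) z.2)
        (B (expRotation (planeGenerator a) s (planeOp a x)) z.2) s := fun x s ↦
      (B.flip z.2).hasFDerivAt.comp_hasDerivAt s (hasDerivAt_expRotation (planeGenerator a) s x)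
    rw [show (deriv fun s ↦ B (expRotation (planeGenerator a) s x) z.2 + e) = _ from
      funext fun s ↦ ((d x s).add_const e).deriv, (d _ 0).deriv, expRotation_zero]
  have h2 : ∀ a y, deriv (deriv fun s ↦ B z.1 (expRotation (planeGenerator a) s y) + e) 0 =
      B z.1 (planeOp a (planeOp a y)) := by
    intro a y
    have d : ∀ (y : EuclideanSpace ℝ (Fin (l + 1))) s,
        HasDerivAt (fun s ↦ B z.1 (expRotation (planeGenerator a) s y))
        (B z.1 (expRotation (planeGenerator a) s (planeOp a y))) s := fun y s ↦
      (B z.1).hasFDerivAt.comp_hasDerivAt s (hasDerivAt_expRotation (planeGenerator a) s y)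
    rw [show (deriv fun s ↦ B z.1 (expRotation (planeGenerator a) s y) + e) = _ from
      funext fun s ↦ ((d y s).add_const e).deriv, (d _ 0).deriv, expRotation_zero]
  rw [rotationLaplacian, Fintype.sum_sum_type]
  refine (congrArg₂ (· + ·) (Finset.sum_congr rfl fun a _ ↦ h1 a z.1)
    (Finset.sum_congr rfl fun a _ ↦ h2 a z.2)).trans ?_
  rw [← sum_apply, ← map_sum, ← map_sum, sum_planeOp_planeOp, sum_planeOp_planeOp]
  simp only [map_smul, smul_apply]
  module

/-- The inclusion of `ℝ^n` into `ℝ^{n+1}` as the first coordinates. -/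
def euclideanSnocZero (n : ℕ) : EuclideanSpace ℝ (Fin n) →ₗ[ℝ] EuclideanSpace ℝ (Fin (n + 1)) where
  toFun v := WithLp.toLp 2 (Fin.snoc (α := fun _ ↦ ℝ) v 0)
  map_add' v w := by
    ext i
    refine Fin.lastCases ?_ (fun i ↦ ?_) i <;> simp
  map_smul' r v := by
    ext i
    refine Fin.lastCases ?_ (fun i ↦ ?_) i <;> simp

theorem norm_euclideanSnocZero (v : EuclideanSpace ℝ (Fin n)) : ‖euclideanSnocZero n v‖ = ‖v‖ := by
  rw [EuclideanSpace.norm_eq, EuclideanSpace.norm_eq, Fin.sum_univ_castSucc]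
  simp [euclideanSnocZero]

theorem liftedMap_eq {p q : ℕ} (f : EuclideanSpace ℝ (Fin p) →ₗ[ℝ] EuclideanSpace ℝ (Fin q) →ₗ[ℝ]
      EuclideanSpace ℝ (Fin n)) (x : EuclideanSpace ℝ (Fin p)) (y : EuclideanSpace ℝ (Fin q)) :
    liftedMap f (x, y) = (1 / √2 : ℝ) • euclideanSnocZero n (f x y) +
      EuclideanSpace.single (Fin.last n) (1 / √2) := by
  ext i
  refine Fin.lastCases ?_ (fun i ↦ ?_) i
  · simp [liftedMap, euclideanSnocZero]
  · simp [liftedMap, euclideanSnocZero, Fin.castSucc_ne_last]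

theorem inner_euclideanSnocZero_single (v : EuclideanSpace ℝ (Fin n)) (r : ℝ) :
    inner ℝ (euclideanSnocZero n v) (EuclideanSpace.single (Fin.last n) r) = 0 := by
  simp [euclideanSnocZero, EuclideanSpace.inner_single_right]

end LiftedMap

theorem theorem2p3 (k l n : ℕ) (hkl : 0 < k + l)
    (f : EuclideanSpace ℝ (Fin (k + 1)) →ₗ[ℝ] EuclideanSpace ℝ (Fin (l + 1)) →ₗ[ℝ]
      EuclideanSpace ℝ (Fin n))
    (hf : IsOrthogonalMultiplication f) :
    ∃ φ : Sphere k × Sphere l → Sphere n,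
      (∀ (x : Sphere k) (y : Sphere l),
        (φ (x, y) : EuclideanSpace ℝ (Fin (n + 1))) = liftedMap f (x, y)) ∧
      IsProperBiharmonic (prodMetric (sphereMetric k) (sphereMetric l))
        ((sphereVolume k).prod (sphereVolume l)) (sphereMetric n) φ := by
  set B : EuclideanSpace ℝ (Fin (k + 1)) →L[ℝ] EuclideanSpace ℝ (Fin (l + 1)) →L[ℝ]
      EuclideanSpace ℝ (Fin (n + 1)) :=
    LinearMap.toContinuousBilinearMap (f.compr₂ ((1 / √2 : ℝ) • euclideanSnocZero n)) with hB
  set e : EuclideanSpace ℝ (Fin (n + 1)) := EuclideanSpace.single (Fin.last n) (1 / √2) with he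
  have hBe : ∀ x y, liftedMap f (x, y) = B x y + e := fun x y ↦ liftedMap_eq f x y
  have hsq : (1 / √2 : ℝ) ^ 2 = 1 / 2 := by rw [div_pow, Real.sq_sqrt (by norm_num), one_pow]
  have hBB : ∀ (x : Sphere k) (y : Sphere l), inner ℝ (B x y) (B x y) = 1 / 2 := by
    intro x y
    have h : B x y = (1 / √2 : ℝ) • euclideanSnocZero n (f x y) := rfl
    rw [real_inner_self_eq_norm_sq, h, norm_smul, norm_euclideanSnocZero, hf, mul_pow]
    simp
  have hBe0 : ∀ x y, inner ℝ (B x y) e = 0 := by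
    intro x y
    have h : B x y = (1 / √2 : ℝ) • euclideanSnocZero n (f x y) := rfl
    rw [h, real_inner_smul_left, inner_euclideanSnocZero_single, mul_zero]
  have hee : inner ℝ e e = 1 / 2 := by
    rw [real_inner_self_eq_norm_sq, he, PiLp.norm_single, Real.norm_eq_abs, sq_abs, hsq]
  have hmem : ∀ z : Sphere k × Sphere l, B z.1 z.2 + e ∈
      Metric.sphere (0 : EuclideanSpace ℝ (Fin (n + 1))) 1 := by
    intro z
    have h : ‖B z.1 z.2 + e‖ ^ 2 = 1 := by
      rw [← real_inner_self_eq_norm_sq, inner_add_left, inner_add_right, inner_add_right, hBB,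
        real_inner_comm (B z.1 z.2) e, hBe0, hee]
      norm_num
    rw [mem_sphere_zero_iff_norm]
    nlinarith [norm_nonneg (B z.1 z.2 + e)]
  have hs : ContMDiff ((𝓡 k).prod (𝓡 l)) 𝓘(ℝ, EuclideanSpace ℝ (Fin (n + 1))) ∞
      (fun z : Sphere k × Sphere l ↦ B z.1 z.2 + e) :=
    ((B.contDiff.contMDiff.comp ((contMDiff_coe_unitSphere k).comp contMDiff_fst)).clm_apply
      ((contMDiff_coe_unitSphere l).comp contMDiff_snd)).add contMDiff_const
  have := Fact.mk (@finrank_euclideanSpace_fin ℝ _ (n + 1))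
  have hφ : ContMDiff ((𝓡 k).prod (𝓡 l)) (𝓡 n) ∞
      (codRestrict (fun z : Sphere k × Sphere l ↦ B z.1 z.2 + e) _ hmem) :=
    hs.codRestrict_sphere hmem
  set φ : Sphere k × Sphere l → Sphere n :=
    codRestrict (fun z : Sphere k × Sphere l ↦ B z.1 z.2 + e) _ hmem with hφdef
  have hφe : ∀ z, (φ z : EuclideanSpace ℝ (Fin (n + 1))) = B z.1 z.2 + e := fun z ↦ rfl
  -- `⟪Δφ, φ⟫ = -(k + l) |B|² = -c`
  set c : ℝ := ((k : ℝ) + l) / 2 with hc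
  have hW : (fun z : Sphere k × Sphere l ↦ (-2 * c) • B z.1 z.2) =
      rotationLaplacian fun z ↦ (φ z : EuclideanSpace ℝ (Fin (n + 1))) := by
    funext z
    refine Eq.trans ?_ (rotationLaplacian_bilinear_add_const B e z).symm
    congr 1
    rw [hc]; ring
  refine ⟨φ, fun x y ↦ (hBe x y).symm, isBiharmonic_of_rotationLaplacian hφ c hW ?_ ?_, ?_⟩
  · intro z
    rw [hφe, real_inner_smul_left, inner_add_right, hBB, hBe0]
    ring
  · intro z
    have h : (fun z : Sphere k × Sphere l ↦
        (-2 * c) • B z.1 z.2 + c • (φ z : EuclideanSpace ℝ (Fin (n + 1)))) =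
        fun z ↦ ((-c) • B) z.1 z.2 + c • e := by
      funext z
      simp only [hφe, smul_apply]
      module
    rw [h, rotationLaplacian_bilinear_add_const]
    simp only [smul_apply, hc]
    module
  · rintro ⟨-, h⟩
    obtain ⟨z⟩ : Nonempty (Sphere k × Sphere l) :=
      ⟨⟨EuclideanSpace.single 0 1, by simp⟩, ⟨EuclideanSpace.single 0 1, by simp⟩⟩
    have h1 := inner_tensionField_self hφ z
    rw [h z, ← hW, map_zero, hφe] at h1
    simp only [real_inner_smul_left, ← real_inner_self_eq_norm_sq, real_inner_smul_right,
      inner_add_right, hBB, hBe0] at h1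
    have hc0 : 0 < c := by
      rw [hc]; exact_mod_cast (by positivity : (0 : ℝ) < ((k + l : ℕ) : ℝ) / 2)
    change (0 : ℝ) = _ at h1
    nlinarith [sq_pos_of_pos hc0]
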